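/- **Syntax.** Let $Var$ be a nonempty at most countable set of propositional letters, $G=\{a_1,\dots,a_m\}$ ($m\ge 0$) a set of agents, and for each $a\in G$ let $A_a\in Var$ be a letter ("$a$ is active"). Formulas are built from letters by $\neg,\wedge$, the temporal operators $\bigcirc$ (next), $U$ (until), $\bullet$ (previous), $S$ (since), the epistemic operators $K_a$ ($a\in G$) and $C$ (common knowledge), and $P_{\ge s}$, $P_{a,\ge s}$ ($a\in G$, $s\in[0,1]\cap\mathbb Q$). Put $\alpha\to\beta:=\neg(\alpha\wedge\neg\beta)$, $\alpha\vee\beta:=\neg(\neg\alpha\wedge\neg\beta)$, $E\alpha:=\bigwedge_{a\in G}K_a\alpha$, $E^0\alpha:=\alpha$, $E^{k+1}\alpha:=EE^k\alpha$, $\Diamond\beta:=(\beta\to\beta)U\beta$, $O\beta:=(\beta\to\beta)S\beta$, $P_{<s}\alpha:=\neg P_{\ge s}\alpha$, $P_{\le s}\alpha:=P_{\ge 1-s}\neg\alpha$, and likewise $P_{a,<s}$, $P_{a,\le s}$. An empty conjunction is a tautology. A *nested implication* is $\Phi(\alpha)=\beta_k\to X_k(\beta_{k-1}\to X_{k-1}(\cdots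 X_1(\beta_0\to\alpha)))$ with $k\ge0$, formulas $\beta_i$ and operators $X_i\in\{K_a:a\in G\}\cup\{\bigcirc,\bullet\}$. **Models.** A model consists of a nonempty family $R$ of runs, where each run $r$ has a sequence $n\mapsto r(n)\subseteq Var$ of valuations ($n\in\mathbb N$; different members of the family may have the same sequence), with worlds $W=R\times\mathbb N$; sets $\mathcal A(w)\subseteq G$ of active agents with $a\in\mathcal A((r,n))$ iff $A_a\in r(n)$; symmetric transitive relations $\mathcal K_a$ on $W$ such that $a\notin\mathcal A(w)$ iff no world is $\mathcal K_a$-accessible from $w$, and $w\mathcal K_aw$ if $a\in\mathcal A(w)$; for each world $w$ an algebra $H^{w}$ of subsets of $R$ with a finitely additive probability $\mu^{w}:H^w\to[0,1]$, and for each agent $a$ a nonempty set $W_a^{w}\subseteq W$, an algebra $H_a^{w}$ of subsets of $W_a^w$ and a finitely additive probability $\mu_a^{w}:H_a^w\to[0,1]$. Satisfaction: $(r,n)\models p$ iff $p\in r(n)$; $\neg,\wedge$ as usual; $(r,n)\models\bigcirc\beta$ iff $(r,n+1)\models\beta$; $(r,n)\models\alpha U\beta$ iff for some $j\ge n$, $(r,j)\models\beta$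 and $(r,k)\models\alpha$ for $n\le k<j$; $(r,n)\models\bullet\beta$ iff $n=0$ or $(r,n-1)\models\beta$; $(r,n)\models\alpha S\beta$ iff for some $j\le n$, $(r,j)\models\beta$ and $(r,k)\models\alpha$ for $j<k\le n$; $w\models K_a\beta$ iff $w'\models\beta$ for all $w'$ with $w\mathcal K_aw'$; $w\models C\beta$ iff $w\models E^k\beta$ for all $k\ge0$; $w\models P_{\ge s}\beta$ iff $\mu^w([\beta])\ge s$; $w\models P_{a,\ge s}\beta$ iff $\mu_a^w([\beta]_a^w)\ge s$, where $[\beta]=\{r\in R:(r,0)\models\beta\}$ and $[\beta]_a^w=\{w'\in W_a^w:w'\models\beta\}$. The model is *measurable* if $[\beta]\in H^w$ and $[\beta]_a^w\in H_a^w$ for all $\beta,w,a$. **Axioms** (all instances): propositional tautologies; $\neg\bigcirc\alpha\leftrightarrow\bigcirc\neg\alpha$; $\bigcirc(\alpha\to\beta)\to(\bigcirc\alpha\to\bigcirc\beta)$; $\alpha U\beta\leftrightarrow\beta\vee(\alpha\wedge\bigcirc(\alpha U\beta))$; $\alpha U\beta\to\Diamond\beta$; $\neg\bullet\neg\alpha\to\bullet\alpha$;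 $\bullet(\alpha\to\beta)\to(\bullet\alpha\to\bullet\beta)$; $(\bullet\alpha\wedge\bullet\beta)\to\bullet(\alpha\wedge\beta)$; $\bigcirc\bullet\alpha\leftrightarrow\alpha$; $\bigcirc\bullet\alpha\to\bullet\bigcirc\alpha$; $\neg\bullet(\gamma\wedge\neg\gamma)\to(\bigcirc\bullet\alpha\leftrightarrow\bullet\bigcirc\alpha)$; $\alpha S\beta\leftrightarrow[\beta\vee(\neg\bullet(\alpha\wedge\neg\alpha)\wedge\alpha\wedge\bullet(\alpha S\beta))]$; $O\bullet\beta$; $K_a(\alpha\to\beta)\to(K_a\alpha\to K_a\beta)$; $A_a\to(K_a\alpha\to\alpha)$; $A_a\to K_aA_a$; $\neg A_a\to K_a(\alpha\wedge\neg\alpha)$; $\neg\alpha\to K_a\neg K_a\alpha$; $K_a\alpha\to K_aK_a\alpha$; $C\alpha\to E^k\alpha$ ($k\ge0$); $P_{\ge1}\bullet(\alpha\wedge\neg\alpha)$; and, both for $P$ and with $P$ replaced by $P_a$ throughout: $P_{\ge0}\alpha$; $P_{\le r}\alpha\to P_{<t}\alpha$ ($t>r$); $P_{<t}\alpha\to P_{\le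 t}\alpha$; $(P_{\ge r}\alpha\wedge P_{\ge t}\beta\wedge P_{\ge1}\neg(\alpha\wedge\beta))\to P_{\ge\min(1,r+t)}(\alpha\vee\beta)$; $(P_{\le r}\alpha\wedge P_{<t}\beta)\to P_{<r+t}(\alpha\vee\beta)$ ($r+t\le1$). **Rules.** Modus ponens; necessitation, only applied to theorems (formulas derivable from $\emptyset$): from $\alpha$ infer $\bigcirc\alpha$, $\bullet\alpha$, $K_a\alpha$, $P_{\ge1}\alpha$, $P_{a,\ge1}\alpha$; and for every nested implication $\Phi$ the infinitary rules: from $\Phi(\neg((\bigwedge_{l<i}\bigcirc^l\alpha)\wedge\bigcirc^i\beta))$ for all $i\ge0$ infer $\Phi(\neg(\alpha U\beta))$; from $\Phi(\neg((\bigwedge_{l<i}\bullet^l\alpha)\wedge(\bigwedge_{l\le i}\neg\bullet^l(\alpha\wedge\neg\alpha))\wedge\bullet^i\beta))$ for all $i\ge0$ infer $\Phi(\neg(\alpha S\beta))$; from $\Phi(E^i\alpha)$ for all $i\ge0$ infer $\Phi(C\alpha)$; for rational $r\in(0,1]$, from $\Phi(P_{\ge r-1/i}\alpha)$ for all $i\ge1/r$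 infer $\Phi(P_{\ge r}\alpha)$, and likewise with $P_a$. A set $T$ of formulas is *consistent* if not every formula is derivable from it (derivations may have countable transfinite length), and *maximal consistent* if moreover no proper superset is consistent. **Canonical model.** Let $Mcs$ be the set of maximal consistent sets containing $\bullet(\alpha\wedge\neg\alpha)$ for every formula $\alpha$. For $S\in Mcs$ put $S_0=S$, $S_{n+1}=\{\alpha:\bigcirc\alpha\in S_n\}$. The runs of $M^*$ are the $r^S$, indexed by $S\in Mcs$, with $r^S(n)=Var\cap S_n$. An agent $a$ is active at $(r^S,n)$ iff $A_a\in S_n$; $(r^S,n)\mathcal K_a(r^{S'},n')$ iff $A_a\in S_n$ and $\{\alpha:K_a\alpha\in S_n\}\subseteq S'_{n'}$. At each world $(r^S,n)$: $H=\{[\![\alpha]\!]:\alpha\text{ a formula}\}$ with $[\![\alpha]\!]=\{r^{S'}:\alpha\in S'_0\}$ and $\mu([\![\alpha]\!])=\sup\{t\in[0,1]\cap\mathbb Q:P_{\ge t}\alpha\in S_n\}$; $W_a$ is the set of all worlds, $H_a=\{[\![\alpha]\!]_a\}$ with $[\![\alpha]\!]_a=\{(r^{S'},n'):\alpha\in S'_{n'}\}$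 and $\mu_a([\![\alpha]\!]_a)=\sup\{t\in[0,1]\cap\mathbb Q:P_{a,\ge t}\alpha\in S_n\}$. **Theorem.** Let $T$ be a consistent set of formulas. Then $M^*$ is well defined (every $S_n$ is maximal consistent, and the values of $\mu$ and $\mu_a$ do not depend on the formulas chosen to represent the sets) and is a measurable model. Moreover $[\![\alpha]\!]=[\alpha]$ and $[\![\alpha]\!]_a=[\alpha]_a$ for all formulas $\alpha$, all agents $a$ and at all worlds; and $T$ has a maximal consistent extension, and every maximal consistent extension of $T$ is $S_n$ for some $S\in Mcs$, $n\ge0$. -/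

import Mathlib

universe u v

namespace PTEL

/-- The rational numbers of the unit interval. -/
abbrev UnitQ : Type := Set.Icc (0 : ℚ) 1

/-- The number `1 - s`. -/
def UnitQ.compl (s : UnitQ) : UnitQ :=
  ⟨1 - s.1, by linarith [s.2.2], by linarith [s.2.1]⟩

/-- The number `1`. -/
def UnitQ.one : UnitQ := ⟨1, by norm_num, le_refl _⟩

/-- The number `0`. -/
def UnitQ.zero : UnitQ := ⟨0, le_refl _, by norm_num⟩

/-- Formulas over the propositional letters `Var` and the agents `Fin m`. -/
inductive Formula (Var : Type u) (m : ℕ) : Type u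
  | var : Var → Formula Var m
  | neg : Formula Var m → Formula Var m
  | conj : Formula Var m → Formula Var m → Formula Var m
  | next : Formula Var m → Formula Var m
  | untl : Formula Var m → Formula Var m → Formula Var m
  | prev : Formula Var m → Formula Var m
  | since : Formula Var m → Formula Var m → Formula Var m
  | know : Fin m → Formula Var m → Formula Var m
  | common : Formula Var m → Formula Var m
  /-- `P_{≥ s} α`, probability on runs -/
  | prob : UnitQ → Formula Var m → Formula Var m
  /-- `P_{a, ≥ s} α`, probability of the agent `a` on possible worlds -/
  | agProb : Fin m → UnitQ → Formula Var m → Formula Var m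

namespace Formula

variable {Var : Type u} {m : ℕ}

def imp (α β : Formula Var m) : Formula Var m := neg (conj α (neg β))
def disj (α β : Formula Var m) : Formula Var m := neg (conj (neg α) (neg β))
def equiv (α β : Formula Var m) : Formula Var m := conj (imp α β) (imp β α)

/-- The contradiction `α ∧ ¬ α`. -/
def contra (α : Formula Var m) : Formula Var m := conj α (neg α)

/-- `⋀ L`; the empty conjunction is the tautology `δ → δ`. -/
def bigConj (δ : Formula Var m) : List (Formula Var m) → Formula Var m
  | [] => imp δ δ
  | [α] => α
  | α :: β :: L => conj α (bigConj δ (β :: L))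

/-- Group knowledge `E α`: the conjunction of all `K_a α`. -/
def groupK (α : Formula Var m) : Formula Var m :=
  bigConj α ((List.finRange m).map fun a => know a α)

def sometime (α : Formula Var m) : Formula Var m := untl (imp α α) α
def once (α : Formula Var m) : Formula Var m := since (imp α α) α

def probLt (s : UnitQ) (α : Formula Var m) : Formula Var m := neg (prob s α)
def probLe (s : UnitQ) (α : Formula Var m) : Formula Var m := prob s.compl (neg α)
def agProbLt (a : Fin m) (s : UnitQ) (α : Formula Var m) : Formula Var m := neg (agProb a s α)
def agProbLe (a : Fin m) (s : UnitQ) (α : Formula Var m) : Formula Var m :=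
  agProb a s.compl (neg α)

/-- The formula `(⋀_{l < i} ○^l α) ∧ ○^i β`. -/
def untilWitness (α β : Formula Var m) (i : ℕ) : Formula Var m :=
  conj (bigConj α ((List.range i).map fun l => next^[l] α)) (next^[i] β)

/-- The formula `(⋀_{l < i} ●^l α) ∧ (⋀_{l ≤ i} ¬ ●^l (α ∧ ¬ α)) ∧ ●^i β`. -/
def sinceWitness (α β : Formula Var m) (i : ℕ) : Formula Var m :=
  conj (conj (bigConj α ((List.range i).map fun l => prev^[l] α))
    (bigConj α ((List.range (i + 1)).map fun l => neg (prev^[l] (contra α))))) (prev^[i] β)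

/-- Instances of classical propositional tautologies: true under every assignment of truth values
to formulas that respects negation and conjunction. -/
def IsTautology (α : Formula Var m) : Prop :=
  ∀ v : Formula Var m → Prop, (∀ β, v (neg β) ↔ ¬ v β) →
    (∀ β γ, v (conj β γ) ↔ (v β ∧ v γ)) → v α

end Formula

open Formula

/-- The operators that may occur in nested implications. -/
inductive NestOp (m : ℕ) : Type
  | know : Fin m → NestOp m
  | next : NestOp m
  | prev : NestOp m

def NestOp.app {Var : Type u} {m : ℕ} : NestOp m → Formula Var m → Formula Var m
  | .know a, α => .know a α
  | .next, α => .next α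
  | .prev, α => .prev α

/-- The `k`-nested implication `β_k → X_k (β_{k-1} → X_{k-1} (… X_1 (β_0 → α)))`. The list is
`[(X_k, β_k), …, (X_1, β_1)]`, so `k` is its length. -/
def nested {Var : Type u} {m : ℕ} (β₀ : Formula Var m) :
    List (NestOp m × Formula Var m) → Formula Var m → Formula Var m
  | [], α => imp β₀ α
  | (X, β) :: L, α => imp β (X.app (nested β₀ L α))

/-- The axioms; `act a` is the propositional letter "agent `a` is active". -/
inductive Ax {Var : Type u} {m : ℕ} (act : Fin m → Var) : Formula Var m → Prop
  | taut (α) : IsTautology α → Ax act α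
  -- time
  | next_neg (α) : Ax act (equiv (neg (next α)) (next (neg α)))
  | next_imp (α β) : Ax act (imp (next (imp α β)) (imp (next α) (next β)))
  | until_next (α β) :
      Ax act (equiv (untl α β) (disj β (conj α (next (untl α β)))))
  | until_sometime (α β) : Ax act (imp (untl α β) (sometime β))
  | prev_neg (α) : Ax act (imp (neg (prev (neg α))) (prev α))
  | prev_imp (α β) : Ax act (imp (prev (imp α β)) (imp (prev α) (prev β)))
  | prev_conj (α β) : Ax act (imp (conj (prev α) (prev β)) (prev (conj α β)))
  | next_prev (α) : Ax act (equiv (next (prev α)) α)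
  | next_prev_comm₁ (α) : Ax act (imp (next (prev α)) (prev (next α)))
  | next_prev_comm₂ (α γ) :
      Ax act (imp (neg (prev (contra γ))) (equiv (next (prev α)) (prev (next α))))
  | since_prev (α β) :
      Ax act (equiv (since α β)
        (disj β (conj (neg (prev (contra α))) (conj α (prev (since α β))))))
  | once_prev (β) : Ax act (once (prev β))
  -- knowledge
  | know_imp (a α β) : Ax act (imp (know a (imp α β)) (imp (know a α) (know a β)))
  | know_refl (a α) : Ax act (imp (var (act a)) (imp (know a α) α))
  | know_act (a) : Ax act (imp (var (act a)) (know a (var (act a))))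
  | know_deadEnd (a α) : Ax act (imp (neg (var (act a))) (know a (contra α)))
  | know_symm (a α) : Ax act (imp (neg α) (know a (neg (know a α))))
  | know_trans (a α) : Ax act (imp (know a α) (know a (know a α)))
  | common_group (α) (k : ℕ) : Ax act (imp (common α) (groupK^[k] α))
  -- probability on runs
  | prob_zero (α) : Ax act (prob UnitQ.zero α)
  | prob_le_lt (r t : UnitQ) (α) : r < t → Ax act (imp (probLe r α) (probLt t α))
  | prob_lt_le (t : UnitQ) (α) : Ax act (imp (probLt t α) (probLe t α))
  | prob_add (r t q : UnitQ) (α β) : (q : ℚ) = min 1 ((r : ℚ) + t) →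
      Ax act (imp (conj (conj (prob r α) (prob t β)) (prob UnitQ.one (neg (conj α β))))
        (prob q (disj α β)))
  | prob_sub (r t q : UnitQ) (α β) : (q : ℚ) = (r : ℚ) + t →
      Ax act (imp (conj (probLe r α) (probLt t β)) (probLt q (disj α β)))
  | prob_prev (α) : Ax act (prob UnitQ.one (prev (contra α)))
  -- probability on possible worlds
  | agProb_zero (a α) : Ax act (agProb a UnitQ.zero α)
  | agProb_le_lt (a) (r t : UnitQ) (α) : r < t → Ax act (imp (agProbLe a r α) (agProbLt a t α))
  | agProb_lt_le (a) (t : UnitQ) (α) : Ax act (imp (agProbLt a t α) (agProbLe a t α))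
  | agProb_add (a) (r t q : UnitQ) (α β) : (q : ℚ) = min 1 ((r : ℚ) + t) →
      Ax act (imp
        (conj (conj (agProb a r α) (agProb a t β)) (agProb a UnitQ.one (neg (conj α β))))
        (agProb a q (disj α β)))
  | agProb_sub (a) (r t q : UnitQ) (α β) : (q : ℚ) = (r : ℚ) + t →
      Ax act (imp (conj (agProbLe a r α) (agProbLt a t β)) (agProbLt a q (disj α β)))

/-- `Derivable act T α`: `α` is derivable from `T`. All rules have at most countably many
premises, so derivations are well-founded countable trees (equivalently, sequences whose length
is a countable successor ordinal). The premises of the necessitation rules must be derivable from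
the empty set, that is, must be theorems of the system. -/
inductive Derivable {Var : Type u} {m : ℕ} (act : Fin m → Var) :
    Set (Formula Var m) → Formula Var m → Prop
  | ax {T α} : Ax act α → Derivable act T α
  | hyp {T α} : α ∈ T → Derivable act T α
  | mp {T α β} : Derivable act T α → Derivable act T (imp α β) → Derivable act T β
  | nec_next {T α} : Derivable act ∅ α → Derivable act T (next α)
  | nec_prev {T α} : Derivable act ∅ α → Derivable act T (prev α)
  | nec_know {T α} (a) : Derivable act ∅ α → Derivable act T (know a α)
  | nec_prob {T α} : Derivable act ∅ α → Derivable act T (prob UnitQ.one α)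
  | nec_agProb {T α} (a) : Derivable act ∅ α → Derivable act T (agProb a UnitQ.one α)
  | untl {T} (β₀ L α β) :
      (∀ i : ℕ, Derivable act T (nested β₀ L (neg (untilWitness α β i)))) →
      Derivable act T (nested β₀ L (neg (untl α β)))
  | since {T} (β₀ L α β) :
      (∀ i : ℕ, Derivable act T (nested β₀ L (neg (sinceWitness α β i)))) →
      Derivable act T (nested β₀ L (neg (since α β)))
  | common {T} (β₀ L α) :
      (∀ i : ℕ, Derivable act T (nested β₀ L (groupK^[i] α))) →
      Derivable act T (nested β₀ L (common α))
  | arch {T} (β₀ L α) (r : UnitQ) : 0 < (r : ℚ) →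
      (∀ (i : ℕ) (q : UnitQ), 1 / (r : ℚ) ≤ i → (q : ℚ) = r - 1 / (i : ℚ) →
        Derivable act T (nested β₀ L (prob q α))) →
      Derivable act T (nested β₀ L (prob r α))
  | agArch {T} (a) (β₀ L α) (r : UnitQ) : 0 < (r : ℚ) →
      (∀ (i : ℕ) (q : UnitQ), 1 / (r : ℚ) ≤ i → (q : ℚ) = r - 1 / (i : ℚ) →
        Derivable act T (nested β₀ L (agProb a q α))) →
      Derivable act T (nested β₀ L (agProb a r α))

/-- A set of formulas is consistent if not every formula is derivable from it. -/
def Consistent {Var : Type u} {m : ℕ} (act : Fin m → Var) (T : Set (Formula Var m)) : Prop :=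
  ¬ ∀ α, Derivable act T α

def MaximalConsistent {Var : Type u} {m : ℕ} (act : Fin m → Var)
    (T : Set (Formula Var m)) : Prop :=
  Consistent act T ∧ ∀ T' : Set (Formula Var m), T ⊂ T' → ¬ Consistent act T'

/-- The data of a model, without its laws (which are in `Structure.IsModel`). Possible worlds are
the pairs `(r, n) : Run × ℕ`. The runs form a family: `val r : ℕ → Set Var` is the sequence of
valuations along the run `r`, and different runs may have the same valuations. The values of
`runMeas` and `agMeas` matter only on the families `runEvents` and `agEvents`. -/
structure Structure (Var : Type u) (m : ℕ) : Type (max u (v + 1)) where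
  Run : Type v
  val : Run → ℕ → Set Var
  /-- active agents -/
  active : Run × ℕ → Set (Fin m)
  /-- accessibility relations -/
  acc : Fin m → Run × ℕ → Run × ℕ → Prop
  runEvents : Run × ℕ → Set (Set Run)
  runMeas : Run × ℕ → Set Run → ℝ
  agWorlds : Fin m → Run × ℕ → Set (Run × ℕ)
  agEvents : (a : Fin m) → (w : Run × ℕ) → Set (Set (agWorlds a w))
  agMeas : (a : Fin m) → (w : Run × ℕ) → Set (agWorlds a w) → ℝ

/-- `μ` restricted to the family `H` is a finitely additive probability measure into `[0, 1]`. -/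
structure IsFinAddProb {X : Type*} (H : Set (Set X)) (μ : Set X → ℝ) : Prop where
  mem_Icc : ∀ A ∈ H, μ A ∈ Set.Icc (0 : ℝ) 1
  univ : μ Set.univ = 1
  union : ∀ A ∈ H, ∀ B ∈ H, Disjoint A B → μ (A ∪ B) = μ A + μ B

namespace Structure

variable {Var : Type u} {m : ℕ}

/-- The laws of a model. -/
structure IsModel (act : Fin m → Var) (M : Structure.{u, v} Var m) : Prop where
  nonempty : Nonempty M.Run
  active_iff : ∀ r n a, a ∈ M.active (r, n) ↔ act a ∈ M.val r n
  symm : ∀ a w w', M.acc a w w' → M.acc a w' w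
  trans : ∀ a w w' w'', M.acc a w w' → M.acc a w' w'' → M.acc a w w''
  not_active_iff : ∀ a w, a ∉ M.active w ↔ ∀ w', ¬ M.acc a w w'
  refl : ∀ a w, a ∈ M.active w → M.acc a w w
  run_algebra : ∀ w, MeasureTheory.IsSetAlgebra (M.runEvents w)
  run_prob : ∀ w, IsFinAddProb (M.runEvents w) (M.runMeas w)
  ag_nonempty : ∀ a w, (M.agWorlds a w).Nonempty
  ag_algebra : ∀ a w, MeasureTheory.IsSetAlgebra (M.agEvents a w)
  ag_prob : ∀ a w, IsFinAddProb (M.agEvents a w) (M.agMeas a w)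

/-- "All agents know": the semantic counterpart of `groupK`. -/
def everyone (M : Structure.{u, v} Var m) (p : M.Run × ℕ → Prop) : M.Run × ℕ → Prop :=
  fun w => ∀ a w', M.acc a w w' → p w'

/-- Satisfaction. The clause for `common β` says that all `groupK^[k] β` hold, see
`sat_common_iff`. -/
def Sat (M : Structure.{u, v} Var m) : Formula Var m → M.Run × ℕ → Prop
  | .var p => fun w => p ∈ M.val w.1 w.2
  | .neg β => fun w => ¬ M.Sat β w
  | .conj α β => fun w => M.Sat α w ∧ M.Sat β w
  | .next β => fun w => M.Sat β (w.1, w.2 + 1)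
  | .untl α β => fun w => ∃ j, w.2 ≤ j ∧ M.Sat β (w.1, j) ∧
      ∀ k, w.2 ≤ k → k < j → M.Sat α (w.1, k)
  | .prev β => fun w => w.2 = 0 ∨ (1 ≤ w.2 ∧ M.Sat β (w.1, w.2 - 1))
  | .since α β => fun w => ∃ j, j ≤ w.2 ∧ M.Sat β (w.1, j) ∧
      ∀ k, j < k → k ≤ w.2 → M.Sat α (w.1, k)
  | .know a β => fun w => ∀ w', M.acc a w w' → M.Sat β w'
  | .common β => fun w => ∀ k : ℕ, (M.everyone)^[k] (M.Sat β) w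
  | .prob s β => fun w => ((s : ℚ) : ℝ) ≤ M.runMeas w {r | M.Sat β (r, 0)}
  | .agProb a s β => fun w => ((s : ℚ) : ℝ) ≤ M.agMeas a w {x | M.Sat β x.1}

theorem sat_bigConj (M : Structure.{u, v} Var m) (δ : Formula Var m) (w : M.Run × ℕ) :
    ∀ L : List (Formula Var m), M.Sat (bigConj δ L) w ↔ ∀ α ∈ L, M.Sat α w
  | [] => by simp [bigConj, imp, Sat]
  | [α] => by simp [bigConj]
  | α :: β :: L => by
      have ih := sat_bigConj M δ w (β :: L)
      simp only [bigConj, Sat, ih, List.forall_mem_cons]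

theorem sat_groupK (M : Structure.{u, v} Var m) (α : Formula Var m) :
    M.Sat (groupK α) = M.everyone (M.Sat α) := by
  funext w
  simp [groupK, sat_bigConj, everyone, Sat]

theorem sat_common_iff (M : Structure.{u, v} Var m) (β : Formula Var m) (w : M.Run × ℕ) :
    M.Sat (common β) w ↔ ∀ k : ℕ, M.Sat (groupK^[k] β) w := by
  have h : ∀ k : ℕ, ∀ γ : Formula Var m,
      M.Sat (groupK^[k] γ) = (M.everyone)^[k] (M.Sat γ) := by
    intro k
    induction k with
    | zero => intro γ; rfl
    | succ k ih => intro γ; simp only [Function.iterate_succ, Function.comp, ih, sat_groupK]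
  simp only [h]
  rfl

/-- The truth set `[β] = {r | (r, 0) ⊨ β}`. -/
def truthRuns (M : Structure.{u, v} Var m) (β : Formula Var m) : Set M.Run :=
  {r | M.Sat β (r, 0)}

/-- The truth set `[β]_a = {w' ∈ W_a | w' ⊨ β}`. -/
def truthWorlds (M : Structure.{u, v} Var m) (a : Fin m) (w : M.Run × ℕ) (β : Formula Var m) :
    Set (M.agWorlds a w) :=
  {x | M.Sat β x.1}

/-- All truth sets are events. -/
def IsMeasurable (M : Structure.{u, v} Var m) : Prop :=
  ∀ (w : M.Run × ℕ) (β : Formula Var m),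
    M.truthRuns β ∈ M.runEvents w ∧ ∀ a, M.truthWorlds a w β ∈ M.agEvents a w

end Structure

section Canonical

variable {Var : Type u} {m : ℕ}

/-- The maximal consistent extensions of `{●(α ∧ ¬ α) : α a formula}`: the starting points of the
canonical runs. -/
def Start (act : Fin m → Var) : Type u :=
  {S : Set (Formula Var m) // MaximalConsistent act S ∧ ∀ α, prev (contra α) ∈ S}

/-- The sequence `S_0 = S`, `S_{n+1} = {α | ○α ∈ S_n}`. -/
def stage (S : Set (Formula Var m)) : ℕ → Set (Formula Var m)
  | 0 => S
  | n + 1 => {α | next α ∈ stage S n}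

/-- The set `S_n` of formulas attached to the world `(r^S, n)`. -/
def label {act : Fin m → Var} (w : Start act × ℕ) : Set (Formula Var m) := stage w.1.1 w.2

/-- The set `⟦α⟧` of the canonical runs `r^S` with `α ∈ S_0`. -/
def synRuns (act : Fin m → Var) (α : Formula Var m) : Set (Start act) :=
  {S | α ∈ label (S, 0)}

/-- The set `⟦α⟧_a` of the canonical worlds `(r^S, n)` in `W` with `α ∈ S_n`. -/
def synWorlds {act : Fin m → Var} (W : Set (Start act × ℕ)) (α : Formula Var m) : Set W :=
  {x | α ∈ label x.1}

/-- The thresholds `s` with `P_{≥ s} α ∈ Γ`. -/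
def runThresholds (Γ : Set (Formula Var m)) (α : Formula Var m) : Set ℝ :=
  {t | ∃ s : UnitQ, prob s α ∈ Γ ∧ t = ((s : ℚ) : ℝ)}

/-- The thresholds `s` with `P_{a, ≥ s} α ∈ Γ`. -/
def agThresholds (a : Fin m) (Γ : Set (Formula Var m)) (α : Formula Var m) : Set ℝ :=
  {t | ∃ s : UnitQ, agProb a s α ∈ Γ ∧ t = ((s : ℚ) : ℝ)}

/-- The canonical structure. The run `r^S` is represented by its index `S`. The measure of a set
`A` is the supremum of the thresholds of the formulas `α` with `A = ⟦α⟧`. -/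
noncomputable def canonical (act : Fin m → Var) : Structure.{u, u} Var m where
  Run := Start act
  val S n := {p | var p ∈ label (S, n)}
  active w := {a | var (act a) ∈ label w}
  acc a w w' := var (act a) ∈ label w ∧ {α | know a α ∈ label w} ⊆ label w'
  runEvents _ := {A | ∃ α, A = synRuns act α}
  runMeas w A := sSup {t | ∃ α, A = synRuns act α ∧ t ∈ runThresholds (label w) α}
  agWorlds _ _ := Set.univ
  agEvents _ _ := {A | ∃ α, A = synWorlds Set.univ α}
  agMeas a w A := sSup {t | ∃ α, A = synWorlds Set.univ α ∧ t ∈ agThresholds a (label w) α}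

end Canonical

end PTEL

namespace PTEL

open Formula

variable {Var : Type u} {m : ℕ} {act : Fin m → Var} {T T' Γ : Set (Formula Var m)}
  {α β γ φ : Formula Var m}

/-! The core is the truth lemma `canonical_sat`: a formula holds at a world of the canonical
structure exactly if it belongs to the label of that world. It is proved by induction on formulas
and rests on three facts.

The nested form of the infinitary rules makes them stable under adding a hypothesis
(`Derivable.deduction`) and under prefixing an operator (`Derivable.necessitation_image`). In a
countable language Lindenbaum's construction can therefore refute a premise whenever it rejects the
conclusion of a rule, so its limit is closed under derivation. Hence a formula lying in all maximal
consistent extensions of a set is derivable from it (`derivable_of_forall_mem`).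

Every maximal consistent set is the label of a world (`MaximalConsistent.exists_label`). The axiom
`once_prev`, applied to `●⊥`, gives a finite number of steps back to a set containing `●⊥`, and away
from such sets `○` undoes `●`. So quantification over maximal consistent sets becomes quantification
over worlds, which settles the knowledge operators.

For a maximal consistent `Γ`, the Archimedean rule puts `P_{≥ s} α` in `Γ` exactly if `s` is at most
the supremum of the thresholds (`IsProbOperator.mem_iff`). The probability axioms then become
complementation and additivity of these suprema. They depend only on the represented set because a
formula representing the full set has probability one. This uses necessitation for worlds, and
additionally the axiom `P_{≥ 1} ●⊥` for runs. -/

/-! ### Countability of the language -/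

/-- An injective numbering of the formulas, given a numbering of the letters. -/
def Formula.code (g : Var → ℕ) : Formula Var m → ℕ
  | .var p => Nat.pair 0 (g p)
  | .neg α => Nat.pair 1 (α.code g)
  | .conj α β => Nat.pair 2 (Nat.pair (α.code g) (β.code g))
  | .next α => Nat.pair 3 (α.code g)
  | .untl α β => Nat.pair 4 (Nat.pair (α.code g) (β.code g))
  | .prev α => Nat.pair 5 (α.code g)
  | .since α β => Nat.pair 6 (Nat.pair (α.code g) (β.code g))
  | .know a α => Nat.pair 7 (Nat.pair a (α.code g))
  | .common α => Nat.pair 8 (α.code g)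
  | .prob s α => Nat.pair 9 (Nat.pair (Encodable.encode s.1) (α.code g))
  | .agProb a s α =>
    Nat.pair 10 (Nat.pair a (Nat.pair (Encodable.encode s.1) (α.code g)))

theorem Formula.code_injective {g : Var → ℕ} (hg : Function.Injective g) :
    Function.Injective (Formula.code g : Formula Var m → ℕ) := by
  intro α
  induction α with
  | var p => intro β h; cases β <;> simp_all [Formula.code, Nat.pair_eq_pair, hg.eq_iff]
  | neg α ih | next α ih | prev α ih | common α ih =>
    intro β h; cases β <;> simp_all [Formula.code, Nat.pair_eq_pair]; exact ih rfl
  | conj α α' ih ih' | untl α α' ih ih' | since α α' ih ih' =>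
    intro β h; cases β <;> simp_all [Formula.code, Nat.pair_eq_pair]; exact ⟨ih rfl, ih' rfl⟩
  | know a α ih =>
    intro β h; cases β <;> simp_all [Formula.code, Nat.pair_eq_pair, Fin.val_inj]; exact ih rfl
  | prob s α ih =>
    intro β h; cases β <;> simp_all [Formula.code, Nat.pair_eq_pair, Subtype.ext_iff]; exact ih rfl
  | agProb a s α ih =>
    intro β h
    cases β <;> simp_all [Formula.code, Nat.pair_eq_pair, Subtype.ext_iff, Fin.val_inj]
    exact ih rfl

instance [Countable Var] : Countable (Formula Var m) := by
  obtain ⟨g, hg⟩ := exists_injective_nat Var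
  exact (Formula.code_injective hg).countable

instance : Countable (NestOp m) :=
  Function.Injective.countable (f := fun X : NestOp m => match X with
    | .know a => (some (some a) : Option (Option (Fin m)))
    | .next => some none
    | .prev => none) (by intro X Y h; cases X <;> cases Y <;> simp_all)

/-! ### Derivability -/

/-- The premises (without the nesting) of the infinitary rule with the given conclusion; a formula
that is not the conclusion of an infinitary rule is its own only premise. -/
def premises : Formula Var m → Set (Formula Var m)
  | .neg (.untl α β) => Set.range fun i => neg (untilWitness α β i)
  | .neg (.since α β) => Set.range fun i => neg (sinceWitness α β i)
  | .common α => Set.range fun i => groupK^[i] α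
  | .prob r α =>
    {p | ∃ (i : ℕ) (q : UnitQ), 1 / (r : ℚ) ≤ i ∧ (q : ℚ) = r - 1 / (i : ℚ) ∧ p = prob q α}
  | .agProb a r α =>
    {p | ∃ (i : ℕ) (q : UnitQ), 1 / (r : ℚ) ≤ i ∧ (q : ℚ) = r - 1 / (i : ℚ) ∧ p = agProb a q α}
  | α => {α}

namespace Derivable

theorem mono (h : Derivable act T α) (hT : T ⊆ T') : Derivable act T' α := by
  induction h generalizing T' with
  | ax h => exact ax h
  | hyp h => exact hyp (hT h)
  | mp _ _ ih₁ ih₂ => exact mp (ih₁ hT) (ih₂ hT)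
  | nec_next h => exact nec_next h
  | nec_prev h => exact nec_prev h
  | nec_know a h => exact nec_know a h
  | nec_prob h => exact nec_prob h
  | nec_agProb a h => exact nec_agProb a h
  | untl β₀ L α β _ ih => exact untl β₀ L α β fun i => ih i hT
  | since β₀ L α β _ ih => exact since β₀ L α β fun i => ih i hT
  | common β₀ L α _ ih => exact common β₀ L α fun i => ih i hT
  | arch β₀ L α r hr _ ih => exact arch β₀ L α r hr fun i q hi hq => ih i q hi hq hT
  | agArch a β₀ L α r hr _ ih => exact agArch a β₀ L α r hr fun i q hi hq => ih i q hi hq hT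

theorem of_empty (h : Derivable act ∅ α) : Derivable act T α := h.mono (Set.empty_subset _)

/-- All infinitary rules in one. -/
theorem limit (β₀ : Formula Var m) (L : List (NestOp m × Formula Var m)) (γ : Formula Var m)
    (h : ∀ p ∈ premises γ, Derivable act T (nested β₀ L p)) : Derivable act T (nested β₀ L γ) := by
  unfold premises at h
  split at h
  · exact untl _ _ _ _ fun i => h _ ⟨i, rfl⟩
  · exact since _ _ _ _ fun i => h _ ⟨i, rfl⟩
  · exact common _ _ _ fun i => h _ ⟨i, rfl⟩
  · rename_i r α
    rcases r.2.1.eq_or_lt with hr | hr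
    -- For `r = 0` there is no Archimedean rule. Since `1 / 0 = 0`, the index `i = 0` makes the
    -- formula its own premise.
    · exact h _ ⟨0, r, by simp [← hr], by simp, rfl⟩
    · exact arch _ _ _ _ hr fun i q hi hq => h _ ⟨i, q, hi, hq, rfl⟩
  · rename_i a r α
    rcases r.2.1.eq_or_lt with hr | hr
    · exact h _ ⟨0, r, by simp [← hr], by simp, rfl⟩
    · exact agArch _ _ _ _ _ hr fun i q hi hq => h _ ⟨i, q, hi, hq, rfl⟩
  · exact h _ rfl

/-- Necessitation applies only to theorems, so axioms and necessitation merge into one case for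
theorems. What remains is hypotheses, modus ponens and a single infinitary case. -/
theorem induction_theorems {motive : Formula Var m → Prop} (h : Derivable act T α)
    (thm : ∀ α, Derivable act ∅ α → motive α) (hyp : ∀ α ∈ T, motive α)
    (mp : ∀ α β, motive α → motive (imp α β) → motive β)
    (limit : ∀ β₀ L γ, (∀ p ∈ premises γ, motive (nested β₀ L p)) → motive (nested β₀ L γ)) :
    motive α := by
  induction h with
  | ax h => exact thm _ (.ax h)
  | hyp h => exact hyp _ h
  | mp _ _ ih₁ ih₂ => exact mp _ _ (ih₁ hyp) (ih₂ hyp)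
  | nec_next h => exact thm _ (.nec_next h)
  | nec_prev h => exact thm _ (.nec_prev h)
  | nec_know a h => exact thm _ (.nec_know a h)
  | nec_prob h => exact thm _ (.nec_prob h)
  | nec_agProb a h => exact thm _ (.nec_agProb a h)
  | untl β₀ L α β _ ih =>
    refine limit β₀ L _ ?_
    rintro _ ⟨i, rfl⟩
    exact ih i hyp
  | since β₀ L α β _ ih =>
    refine limit β₀ L _ ?_
    rintro _ ⟨i, rfl⟩
    exact ih i hyp
  | common β₀ L α _ ih =>
    refine limit β₀ L _ ?_
    rintro _ ⟨i, rfl⟩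
    exact ih i hyp
  | arch β₀ L α r hr _ ih =>
    refine limit β₀ L _ ?_
    rintro _ ⟨i, q, hi, hq, rfl⟩
    exact ih i q hi hq hyp
  | agArch a β₀ L α r hr _ ih =>
    refine limit β₀ L _ ?_
    rintro _ ⟨i, q, hi, hq, rfl⟩
    exact ih i q hi hq hyp

theorem taut (h : IsTautology α) : Derivable act T α := ax (.taut _ h)

theorem taut_mp (h : Derivable act T α) (ht : IsTautology (imp α β)) : Derivable act T β :=
  h.mp (taut ht)

theorem taut_mp₂ (h₁ : Derivable act T α) (h₂ : Derivable act T β)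
    (ht : IsTautology (imp α (imp β γ))) : Derivable act T γ :=
  h₂.mp (h₁.mp (taut ht))

/-- An extra antecedent can be conjoined to the outermost antecedent of a nested implication. This
carries the deduction theorem through the infinitary rules. -/
theorem nested_conj_iff (φ β₀ : Formula Var m) (L : List (NestOp m × Formula Var m)) :
    ∃ β₀' L', ∀ T α, Derivable act T (nested β₀' L' α) ↔
      Derivable act T (imp φ (nested β₀ L α)) := by
  rcases L with _ | ⟨⟨X, β⟩, L⟩
  · refine ⟨conj φ β₀, [], fun T α => ⟨fun h => h.taut_mp ?_, fun h => h.taut_mp ?_⟩⟩ <;>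
    · intro v hn hc
      simp only [nested, imp, hn, hc]
      tauto
  · refine ⟨β₀, (X, conj φ β) :: L, fun T α => ⟨fun h => h.taut_mp ?_, fun h => h.taut_mp ?_⟩⟩ <;>
    · intro v hn hc
      simp only [nested, imp, hn, hc]
      tauto

/-- The deduction theorem. -/
theorem deduction (h : Derivable act (insert φ T) α) : Derivable act T (imp φ α) := by
  refine h.induction_theorems (motive := fun α => Derivable act T (imp φ α)) ?_ ?_ ?_ ?_
  · intro α h
    exact h.of_empty.taut_mp fun v hn hc => by simp only [imp, hn, hc]; tauto
  · rintro α (rfl | h)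
    · exact taut fun v hn hc => by simp only [imp, hn, hc]; tauto
    · exact (hyp h).taut_mp fun v hn hc => by simp only [imp, hn, hc]; tauto
  · intro α β h₁ h₂
    exact h₁.taut_mp₂ h₂ fun v hn hc => by simp only [imp, hn, hc]; tauto
  · intro β₀ L γ h
    obtain ⟨β₀', L', hL⟩ := nested_conj_iff (act := act) φ β₀ L
    exact (hL T γ).1 (limit _ _ _ fun p hp => (hL T p).2 (h p hp))

theorem necessitation (X : NestOp m) (h : Derivable act ∅ α) : Derivable act T (X.app α) := by
  cases X
  exacts [h.nec_know _, h.nec_next, h.nec_prev]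

theorem app_imp (X : NestOp m) (α β : Formula Var m) :
    Derivable act T (imp (X.app (imp α β)) (imp (X.app α) (X.app β))) := by
  cases X
  exacts [ax (.know_imp _ _ _), ax (.next_imp _ _), ax (.prev_imp _ _)]

/-- Strong necessitation. -/
theorem necessitation_image (X : NestOp m) (h : Derivable act T α) :
    Derivable act (X.app '' T) (X.app α) := by
  refine h.induction_theorems (motive := fun α => Derivable act (X.app '' T) (X.app α)) ?_ ?_ ?_ ?_
  · exact fun _ h => h.necessitation X
  · exact fun _ h => hyp ⟨_, h, rfl⟩
  · exact fun α β h₁ h₂ => h₁.mp (h₂.mp (app_imp X α β))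
  · intro β₀ L γ h
    -- With the tautology `γ → γ` as new outermost antecedent, `X` applied to a nested implication
    -- is equivalent to a nested implication one level deeper, so the infinitary rule applies again.
    have h' : Derivable act (X.app '' T) (nested β₀ ((X, imp γ γ) :: L) γ) := by
      refine limit _ _ _ fun p hp => (h p hp).taut_mp fun v hn hc => ?_
      simp only [nested, imp, hn, hc]
      tauto
    refine h'.taut_mp fun v hn hc => ?_
    simp only [nested, imp, hn, hc]
    tauto

end Derivable

/-! ### Consistency -/

theorem not_consistent (h : Derivable act T α) (h' : Derivable act T (neg α)) :
    ¬ Consistent act T := fun hT => hT fun β =>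
  h.taut_mp₂ h' fun v hn hc => by simp only [imp, hn, hc]; tauto

theorem derivable_neg_of_not_consistent (h : ¬ Consistent act (insert α T)) :
    Derivable act T (neg α) :=
  (Derivable.deduction (not_not.1 h (neg α))).taut_mp fun v hn hc => by
    simp only [imp, hn, hc]; tauto

theorem derivable_of_not_consistent (h : ¬ Consistent act (insert (neg α) T)) :
    Derivable act T α :=
  (derivable_neg_of_not_consistent h).taut_mp fun v hn hc => by
    simp only [imp, hn, hc]; tauto

/-- A proper superset contains some `α` outside `Γ` together with `¬ α` from `Γ`. Here, and as an
argument of later lemmas, `φ` only witnesses that formulas exist. -/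
theorem maximalConsistent_of_closed (hΓ : ∀ α, Derivable act Γ α → α ∈ Γ)
    (hneg : ∀ α, neg α ∈ Γ ↔ α ∉ Γ) (φ : Formula Var m) : MaximalConsistent act Γ := by
  refine ⟨fun h => (hneg φ).1 (hΓ _ (h _)) (hΓ _ (h _)), fun T hT => ?_⟩
  obtain ⟨hsub, α, hα, hα'⟩ := Set.ssubset_iff_exists.1 hT
  exact not_consistent (.hyp hα) (.hyp (hsub ((hneg α).2 hα')))

namespace MaximalConsistent

theorem mem_of_derivable (hΓ : MaximalConsistent act Γ) (h : Derivable act Γ α) : α ∈ Γ := by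
  by_contra hα
  have h' := derivable_neg_of_not_consistent (hΓ.2 _ (Set.ssubset_insert hα))
  exact not_consistent h h' hΓ.1

theorem mem_of_theorem (hΓ : MaximalConsistent act Γ) (h : Derivable act ∅ α) : α ∈ Γ :=
  hΓ.mem_of_derivable h.of_empty

theorem mem_neg (hΓ : MaximalConsistent act Γ) (α : Formula Var m) : neg α ∈ Γ ↔ α ∉ Γ := by
  refine ⟨fun h h' => not_consistent (.hyp h') (.hyp h) hΓ.1, fun hα => ?_⟩
  exact hΓ.mem_of_derivable (derivable_neg_of_not_consistent (hΓ.2 _ (Set.ssubset_insert hα)))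

theorem mem_conj (hΓ : MaximalConsistent act Γ) (α β : Formula Var m) :
    conj α β ∈ Γ ↔ α ∈ Γ ∧ β ∈ Γ := by
  refine ⟨fun h => ⟨?_, ?_⟩, fun h => ?_⟩
  · exact hΓ.mem_of_derivable ((Derivable.hyp h).taut_mp fun v hn hc => by
      simp only [imp, hn, hc]; tauto)
  · exact hΓ.mem_of_derivable ((Derivable.hyp h).taut_mp fun v hn hc => by
      simp only [imp, hn, hc]; tauto)
  · exact hΓ.mem_of_derivable ((Derivable.hyp h.1).taut_mp₂ (.hyp h.2) fun v hn hc => by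
      simp only [imp, hn, hc]; tauto)

theorem mem_imp (hΓ : MaximalConsistent act Γ) (α β : Formula Var m) :
    imp α β ∈ Γ ↔ (α ∈ Γ → β ∈ Γ) := by
  rw [imp, hΓ.mem_neg, hΓ.mem_conj, hΓ.mem_neg]
  tauto

theorem mem_disj (hΓ : MaximalConsistent act Γ) (α β : Formula Var m) :
    disj α β ∈ Γ ↔ α ∈ Γ ∨ β ∈ Γ := by
  rw [disj, hΓ.mem_neg, hΓ.mem_conj, hΓ.mem_neg, hΓ.mem_neg]
  tauto

theorem mem_equiv (hΓ : MaximalConsistent act Γ) (α β : Formula Var m) :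
    equiv α β ∈ Γ ↔ (α ∈ Γ ↔ β ∈ Γ) := by
  rw [equiv, hΓ.mem_conj, hΓ.mem_imp, hΓ.mem_imp]
  tauto

theorem contra_notMem (hΓ : MaximalConsistent act Γ) (α : Formula Var m) : contra α ∉ Γ := by
  rw [contra, hΓ.mem_conj, hΓ.mem_neg]
  tauto

theorem mem_bigConj (hΓ : MaximalConsistent act Γ) (δ : Formula Var m) :
    ∀ L : List (Formula Var m), bigConj δ L ∈ Γ ↔ ∀ α ∈ L, α ∈ Γ
  | [] => by simp [bigConj, hΓ.mem_imp]
  | [α] => by simp [bigConj]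
  | α :: β :: L => by
      rw [bigConj, hΓ.mem_conj, hΓ.mem_bigConj δ (β :: L)]
      simp only [List.forall_mem_cons]

theorem mem_of_ax (hΓ : MaximalConsistent act Γ) (h : Ax act α) : α ∈ Γ :=
  hΓ.mem_of_derivable (.ax h)

theorem mem_of_ax_imp (hΓ : MaximalConsistent act Γ) (h : Ax act (imp α β)) (hα : α ∈ Γ) :
    β ∈ Γ :=
  (hΓ.mem_imp α β).1 (hΓ.mem_of_ax h) hα

theorem mem_limit (hΓ : MaximalConsistent act Γ) (h : ∀ p ∈ premises γ, p ∈ Γ) : γ ∈ Γ := by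
  -- The rules conclude nested implications only; nesting depth zero with a tautological antecedent
  -- gives the plain rule.
  have h' : nested (imp γ γ) [] γ ∈ Γ := hΓ.mem_of_derivable <| .limit _ _ _ fun p hp => .hyp <| by
    rw [nested, hΓ.mem_imp]
    exact fun _ => h p hp
  rw [nested, hΓ.mem_imp, hΓ.mem_imp] at h'
  exact h' id

theorem exists_premise_notMem (hΓ : MaximalConsistent act Γ) (h : γ ∉ Γ) :
    ∃ p ∈ premises γ, p ∉ Γ := by
  by_contra! hp
  exact h (hΓ.mem_limit hp)

theorem app_mem_of_derivable (hΓ : MaximalConsistent act Γ) (X : NestOp m)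
    (h : Derivable act {β | X.app β ∈ Γ} α) : X.app α ∈ Γ :=
  hΓ.mem_of_derivable ((h.necessitation_image X).mono (by rintro _ ⟨β, hβ, rfl⟩; exact hβ))

theorem app_mem_mono (hΓ : MaximalConsistent act Γ) (X : NestOp m)
    (h : IsTautology (imp α β)) (hα : X.app α ∈ Γ) : X.app β ∈ Γ :=
  hΓ.app_mem_of_derivable X ((Derivable.hyp (by exact hα)).taut_mp h)

theorem maximalConsistent_preimage (hΓ : MaximalConsistent act Γ) (X : NestOp m)
    (h : ∀ α, X.app (neg α) ∈ Γ ↔ X.app α ∉ Γ) (φ : Formula Var m) :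
    MaximalConsistent act {α | X.app α ∈ Γ} :=
  maximalConsistent_of_closed (fun _ => hΓ.app_mem_of_derivable X) h φ

end MaximalConsistent

/-! ### Lindenbaum's lemma -/

theorem Consistent.exists_decide (hT : Consistent act T) (α : Formula Var m) :
    ∃ T', T ⊆ T' ∧ Consistent act T' ∧ (α ∈ T' ∨ neg α ∈ T') := by
  by_cases h : Consistent act (insert α T)
  · exact ⟨_, Set.subset_insert _ _, h, .inl (Set.mem_insert _ _)⟩
  · refine ⟨insert (neg α) T, Set.subset_insert _ _, fun h' => ?_, .inr (Set.mem_insert _ _)⟩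
    exact not_consistent (derivable_of_not_consistent (not_not.2 h'))
      (derivable_neg_of_not_consistent h) hT

/-- The Henkin step: if neither the conclusion nor the negation of any premise could be added
consistently, all premises would be derivable, hence also the conclusion, whose negation is
derivable as well. -/
theorem Consistent.exists_refute (hT : Consistent act T) (β₀ : Formula Var m)
    (L : List (NestOp m × Formula Var m)) (γ : Formula Var m) :
    ∃ T', T ⊆ T' ∧ Consistent act T' ∧
      (nested β₀ L γ ∈ T' ∨ ∃ p ∈ premises γ, neg (nested β₀ L p) ∈ T') := by
  by_cases h : Consistent act (insert (nested β₀ L γ) T)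
  · exact ⟨_, Set.subset_insert _ _, h, .inl (Set.mem_insert _ _)⟩
  · by_cases h' : ∃ p ∈ premises γ, Consistent act (insert (neg (nested β₀ L p)) T)
    · obtain ⟨p, hp, h'⟩ := h'
      exact ⟨_, Set.subset_insert _ _, h', .inr ⟨p, hp, Set.mem_insert _ _⟩⟩
    · push Not at h'
      exact absurd hT (not_consistent
        (.limit β₀ L γ fun p hp => derivable_of_not_consistent (h' p hp))
        (derivable_neg_of_not_consistent h))

/-- Lindenbaum's lemma. -/
theorem Consistent.exists_maximalConsistent [Countable Var] (hT : Consistent act T)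
    (φ : Formula Var m) : ∃ Γ, T ⊆ Γ ∧ MaximalConsistent act Γ := by
  let ι := Formula Var m × Formula Var m × List (NestOp m × Formula Var m) × Formula Var m
  have : Nonempty ι := ⟨φ, φ, [], φ⟩
  -- Each index carries two tasks: a formula to decide and a possible conclusion of an infinitary
  -- rule to accept or refute.
  obtain ⟨e, he⟩ := exists_surjective_nat ι
  have step : ∀ (k : ι) (T : {T // Consistent act T}), ∃ T' : {T // Consistent act T},
      T.1 ⊆ T'.1 ∧ (k.1 ∈ T'.1 ∨ neg k.1 ∈ T'.1) ∧ (nested k.2.1 k.2.2.1 k.2.2.2 ∈ T'.1 ∨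
        ∃ p ∈ premises k.2.2.2, neg (nested k.2.1 k.2.2.1 p) ∈ T'.1) := by
    rintro k ⟨T, hT⟩
    obtain ⟨T₁, h₁, hT₁, hk₁⟩ := hT.exists_decide k.1
    obtain ⟨T₂, h₂, hT₂, hk₂⟩ := hT₁.exists_refute k.2.1 k.2.2.1 k.2.2.2
    exact ⟨⟨T₂, hT₂⟩, h₁.trans h₂, hk₁.imp (@h₂ _) (@h₂ _), hk₂⟩
  choose f hf_sub hf_dec hf_ref using step
  let s : ℕ → {T // Consistent act T} := fun n => Nat.rec ⟨T, hT⟩ (fun n T => f (e n) T) n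
  have hs : ∀ n, s (n + 1) = f (e n) (s n) := fun _ => rfl
  have hmono : Monotone fun n => (s n).1 := monotone_nat_of_le_succ fun n => hf_sub _ _
  set Γ := ⋃ n, (s n).1 with hΓ
  have hsub : ∀ n, (s n).1 ⊆ Γ := fun n => Set.subset_iUnion (fun n => (s n).1) n
  have hclash : ∀ α, α ∈ Γ → neg α ∈ Γ → False := by
    intro α h₁ h₂
    obtain ⟨i, hi⟩ := Set.mem_iUnion.1 h₁
    obtain ⟨j, hj⟩ := Set.mem_iUnion.1 h₂
    exact not_consistent (.hyp (hmono (le_max_left i j) hi)) (.hyp (hmono (le_max_right i j) hj))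
      (s (max i j)).2
  have hdec : ∀ α, α ∈ Γ ∨ neg α ∈ Γ := by
    intro α
    obtain ⟨n, hn⟩ := he (α, φ, [], φ)
    have := hf_dec (e n) (s n)
    rw [← hs, hn] at this
    exact Or.imp (@hsub (n + 1) _) (@hsub (n + 1) _) this
  refine ⟨Γ, hsub 0, maximalConsistent_of_closed (fun α hα => ?_)
    (fun α => ⟨fun h h' => hclash α h' h, (hdec α).resolve_left⟩) φ⟩
  -- Derivations may use infinitely many hypotheses, so consistency of the stages does not pass to
  -- the union by compactness. Closure under derivation is shown instead; in the infinitary case the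
  -- refuted premise would contradict the induction hypothesis.
  refine hα.induction_theorems ?_ (fun _ => id) ?_ ?_
  · intro α h
    refine (hdec α).resolve_right fun hn => ?_
    obtain ⟨i, hi⟩ := Set.mem_iUnion.1 hn
    exact not_consistent h.of_empty (.hyp hi) (s i).2
  · intro α β h₁ h₂
    refine (hdec β).resolve_right fun hn => ?_
    obtain ⟨i, hi⟩ := Set.mem_iUnion.1 h₁
    obtain ⟨j, hj⟩ := Set.mem_iUnion.1 h₂
    obtain ⟨k, hk⟩ := Set.mem_iUnion.1 hn
    let n := max (max i j) k
    exact not_consistent (act := act) (T := (s n).1) (α := β)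
      ((Derivable.hyp (hmono ((le_max_left i j).trans (le_max_left _ k)) hi)).mp
        (.hyp (hmono ((le_max_right i j).trans (le_max_left _ k)) hj)))
      (.hyp (hmono (le_max_right _ k) hk)) (s n).2
  · intro β₀ L γ h
    obtain ⟨n, hn⟩ := he (φ, β₀, L, γ)
    have := hf_ref (e n) (s n)
    rw [← hs, hn] at this
    rcases this with h' | ⟨p, hp, h'⟩
    · exact hsub (n + 1) h'
    · exact (hclash _ (h p hp) (hsub (n + 1) h')).elim

/-- Completeness with respect to maximal consistent sets. -/
theorem derivable_of_forall_mem [Countable Var]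
    (h : ∀ Γ, MaximalConsistent act Γ → T ⊆ Γ → α ∈ Γ) : Derivable act T α := by
  by_contra hα
  have hT : Consistent act (insert (neg α) T) := by
    by_contra h'
    exact hα (derivable_of_not_consistent h')
  obtain ⟨Γ, hsub, hΓ⟩ := hT.exists_maximalConsistent α
  exact (hΓ.mem_neg α).1 (hsub (Set.mem_insert _ _))
    (h Γ hΓ ((Set.subset_insert _ _).trans hsub))

/-! ### Probability operators -/

/-- The laws shared by the operators `P_{≥ s}` and `P_{a, ≥ s}`. -/
structure IsProbOperator (act : Fin m → Var) (P : UnitQ → Formula Var m → Formula Var m) :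
    Prop where
  zero (α : Formula Var m) : Ax act (P UnitQ.zero α)
  le_lt (r t : UnitQ) (α : Formula Var m) : r < t → Ax act (imp (P r.compl (neg α)) (neg (P t α)))
  lt_le (t : UnitQ) (α : Formula Var m) : Ax act (imp (neg (P t α)) (P t.compl (neg α)))
  add (r t q : UnitQ) (α β : Formula Var m) : (q : ℚ) = min 1 ((r : ℚ) + t) →
    Ax act (imp (conj (conj (P r α) (P t β)) (P UnitQ.one (neg (conj α β)))) (P q (disj α β)))
  sub (r t q : UnitQ) (α β : Formula Var m) : (q : ℚ) = (r : ℚ) + t →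
    Ax act (imp (conj (P r.compl (neg α)) (neg (P t β))) (neg (P q (disj α β))))
  nec (α : Formula Var m) : Derivable act ∅ α → Derivable act ∅ (P UnitQ.one α)
  arch (r : UnitQ) (α : Formula Var m) : ∀ p ∈ premises (P r α), ∃ (i : ℕ) (q : UnitQ),
    1 / (r : ℚ) ≤ i ∧ (q : ℚ) = r - 1 / (i : ℚ) ∧ p = P q α

theorem isProbOperator_prob : IsProbOperator act (prob : UnitQ → Formula Var m → _) where
  zero := .prob_zero
  le_lt := .prob_le_lt
  lt_le := .prob_lt_le
  add := .prob_add
  sub := .prob_sub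
  nec _ := .nec_prob
  arch _ _ _ hp := hp

theorem isProbOperator_agProb (a : Fin m) :
    IsProbOperator act (agProb a : UnitQ → Formula Var m → _) where
  zero := .agProb_zero a
  le_lt := .agProb_le_lt a
  lt_le := .agProb_lt_le a
  add := .agProb_add a
  sub := .agProb_sub a
  nec _ := .nec_agProb a
  arch _ _ _ hp := hp

/-- The thresholds `s` with `P s α ∈ Γ`, for an arbitrary operator `P`. -/
def thresholds (P : UnitQ → Formula Var m → Formula Var m) (Γ : Set (Formula Var m))
    (α : Formula Var m) : Set ℝ :=
  {t | ∃ s : UnitQ, P s α ∈ Γ ∧ t = ((s : ℚ) : ℝ)}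

theorem UnitQ.exists_between {x y : ℝ} (hx : 0 ≤ x) (hy : y ≤ 1) (h : x < y) :
    ∃ s : UnitQ, x < ((s : ℚ) : ℝ) ∧ ((s : ℚ) : ℝ) < y := by
  obtain ⟨q, h₁, h₂⟩ := exists_rat_btwn h
  exact ⟨⟨q, by exact_mod_cast hx.trans h₁.le, by exact_mod_cast h₂.le.trans hy⟩, h₁, h₂⟩

theorem UnitQ.cast_nonneg (s : UnitQ) : (0 : ℝ) ≤ ((s : ℚ) : ℝ) := by exact_mod_cast s.2.1

theorem UnitQ.cast_le_one (s : UnitQ) : ((s : ℚ) : ℝ) ≤ 1 := by exact_mod_cast s.2.2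

theorem UnitQ.cast_compl (s : UnitQ) : ((s.compl : ℚ) : ℝ) = 1 - ((s : ℚ) : ℝ) := by
  simp [UnitQ.compl]

theorem UnitQ.compl_compl (s : UnitQ) : s.compl.compl = s :=
  Subtype.ext (sub_sub_cancel 1 s.1)

theorem UnitQ.cast_one : (((UnitQ.one : UnitQ) : ℚ) : ℝ) = 1 := by simp [UnitQ.one]

namespace IsProbOperator

variable {P : UnitQ → Formula Var m → Formula Var m}

theorem isLUB_thresholds (hP : IsProbOperator act P) (hΓ : MaximalConsistent act Γ)
    (α : Formula Var m) : IsLUB (thresholds P Γ α) (sSup (thresholds P Γ α)) := by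
  refine isLUB_csSup ⟨_, _, hΓ.mem_of_ax (hP.zero α), rfl⟩ ⟨1, ?_⟩
  rintro _ ⟨s, -, rfl⟩
  exact s.cast_le_one

theorem sSup_nonneg (α : Formula Var m) : 0 ≤ sSup (thresholds P Γ α) := by
  refine Real.sSup_nonneg ?_
  rintro _ ⟨s, -, rfl⟩
  exact s.cast_nonneg

theorem sSup_le_one (α : Formula Var m) : sSup (thresholds P Γ α) ≤ 1 := by
  refine Real.sSup_le ?_ zero_le_one
  rintro _ ⟨s, -, rfl⟩
  exact s.cast_le_one

theorem mem_of_lt (hP : IsProbOperator act P) (hΓ : MaximalConsistent act Γ) {s t : UnitQ}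
    (hst : s < t) (ht : P t α ∈ Γ) : P s α ∈ Γ := by
  by_contra hs
  have h₁ := hΓ.mem_of_ax_imp (hP.lt_le s α) ((hΓ.mem_neg _).2 hs)
  exact (hΓ.mem_neg _).1 (hΓ.mem_of_ax_imp (hP.le_lt s t α hst) h₁) ht

/-- The thresholds are closed downwards by `mem_of_lt`, and the Archimedean rule adds their supremum
if it is rational. -/
theorem mem_iff (hP : IsProbOperator act P) (hΓ : MaximalConsistent act Γ) (s : UnitQ)
    (α : Formula Var m) : P s α ∈ Γ ↔ ((s : ℚ) : ℝ) ≤ sSup (thresholds P Γ α) := by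
  have hlub := hP.isLUB_thresholds hΓ α
  refine ⟨fun h => hlub.1 ⟨s, h, rfl⟩, fun h => ?_⟩
  rcases s.2.1.eq_or_lt with hs | hs
  · have : s = UnitQ.zero := Subtype.ext hs.symm
    exact this ▸ hΓ.mem_of_ax (hP.zero α)
  · refine hΓ.mem_limit fun p hp => ?_
    obtain ⟨i, q, hi, hq, rfl⟩ := hP.arch s α p hp
    -- The bound `1 / s ≤ i` excludes `i = 0`, where `1 / i = 0` would give `q = s`.
    have hi' : (0 : ℚ) < i := (one_div_pos.2 hs).trans_le hi
    have hqs : (q : ℚ) < s := by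
      rw [hq]
      linarith [one_div_pos.2 hi']
    obtain ⟨_, ⟨t, ht, rfl⟩, hlt, -⟩ :=
      hlub.exists_between (b := ((q : ℚ) : ℝ)) (lt_of_lt_of_le (by exact_mod_cast hqs) h)
    exact hP.mem_of_lt hΓ (s := q) (t := t) (by exact_mod_cast hlt) ht

theorem sSup_neg (hP : IsProbOperator act P) (hΓ : MaximalConsistent act Γ) (α : Formula Var m) :
    sSup (thresholds P Γ (neg α)) = 1 - sSup (thresholds P Γ α) := by
  have h0 := sSup_nonneg (P := P) (Γ := Γ)
  have h1 := sSup_le_one (P := P) (Γ := Γ)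
  refine le_antisymm (le_of_not_gt fun h => ?_) (le_of_not_gt fun h => ?_)
  -- With `μ` for the supremum: `1 - μ(α) < r < μ(¬α)` and `1 - r < t < μ(α)`. Then `P_{≤ 1-r} α`
  -- yields `P_{< t} α`, against `t < μ(α)`.
  · obtain ⟨r, hr, hr'⟩ := UnitQ.exists_between (by linarith [h1 α]) (h1 (neg α)) h
    obtain ⟨t, ht, ht'⟩ := UnitQ.exists_between (x := 1 - ((r : ℚ) : ℝ))
      (by linarith [r.cast_le_one]) (h1 α) (by linarith)
    have hrt : r.compl < t := by
      rw [← UnitQ.cast_compl] at ht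
      exact_mod_cast ht
    have h₁ : P r.compl.compl (neg α) ∈ Γ := by
      rw [UnitQ.compl_compl]
      exact (hP.mem_iff hΓ _ _).2 hr'.le
    exact (hΓ.mem_neg _).1 (hΓ.mem_of_ax_imp (hP.le_lt _ _ α hrt) h₁)
      ((hP.mem_iff hΓ _ _).2 ht'.le)
  · obtain ⟨s, hs, hs'⟩ := UnitQ.exists_between (h0 (neg α)) (by linarith [h0 α]) h
    have h₁ : P s.compl α ∉ Γ := by
      rw [hP.mem_iff hΓ, UnitQ.cast_compl]
      linarith
    have h₂ := hΓ.mem_of_ax_imp (hP.lt_le _ α) ((hΓ.mem_neg _).2 h₁)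
    rw [UnitQ.compl_compl, hP.mem_iff hΓ] at h₂
    linarith

theorem sSup_disj_le (hP : IsProbOperator act P) (hΓ : MaximalConsistent act Γ)
    (α β : Formula Var m) : sSup (thresholds P Γ (disj α β)) ≤
      sSup (thresholds P Γ α) + sSup (thresholds P Γ β) := by
  have h0 := sSup_nonneg (P := P) (Γ := Γ)
  have h1 := sSup_le_one (P := P) (Γ := Γ) (disj α β)
  refine le_of_not_gt fun h => ?_
  -- Half the gap for each summand keeps `r + t` below the supremum for `α ∨ β`, hence below `1`, as
  -- the axiom `sub` requires.
  set d := (sSup (thresholds P Γ (disj α β)) -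
    (sSup (thresholds P Γ α) + sSup (thresholds P Γ β))) / 2 with hd
  obtain ⟨r, hr, hr'⟩ := UnitQ.exists_between (h0 α) (y := sSup (thresholds P Γ α) + d)
    (by linarith [h0 α, h0 β]) (by linarith)
  obtain ⟨t, ht, ht'⟩ := UnitQ.exists_between (h0 β) (y := sSup (thresholds P Γ β) + d)
    (by linarith [h0 α, h0 β]) (by linarith)
  have hrt : ((r : ℚ) : ℝ) + ((t : ℚ) : ℝ) ≤ 1 := by linarith
  let q : UnitQ := ⟨r + t, add_nonneg r.2.1 t.2.1, by exact_mod_cast hrt⟩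
  have hr₁ : P r.compl (neg α) ∈ Γ := by
    rw [hP.mem_iff hΓ, UnitQ.cast_compl, hP.sSup_neg hΓ]
    linarith
  have ht₁ : neg (P t β) ∈ Γ := by
    rw [hΓ.mem_neg, hP.mem_iff hΓ]
    linarith
  have hq := hΓ.mem_of_ax_imp (hP.sub r t q α β rfl) ((hΓ.mem_conj _ _).2 ⟨hr₁, ht₁⟩)
  rw [hΓ.mem_neg, hP.mem_iff hΓ] at hq
  refine hq ?_
  change (((r : ℚ) + (t : ℚ) : ℚ) : ℝ) ≤ _
  push_cast
  linarith

/-- The bound `hle` keeps the truncation at `1` in the axiom `add` inactive. -/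
theorem le_sSup_disj (hP : IsProbOperator act P) (hΓ : MaximalConsistent act Γ)
    {α β : Formula Var m} (hαβ : P UnitQ.one (neg (conj α β)) ∈ Γ)
    (hle : sSup (thresholds P Γ α) + sSup (thresholds P Γ β) ≤ 1) :
    sSup (thresholds P Γ α) + sSup (thresholds P Γ β) ≤ sSup (thresholds P Γ (disj α β)) := by
  refine le_of_forall_pos_lt_add fun ε hε => ?_
  have hα := hP.isLUB_thresholds hΓ α
  have hβ := hP.isLUB_thresholds hΓ β
  obtain ⟨_, ⟨r, hr, rfl⟩, hr', -⟩ := hα.exists_between (sub_lt_self _ (half_pos hε))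
  obtain ⟨_, ⟨t, ht, rfl⟩, ht', -⟩ := hβ.exists_between (sub_lt_self _ (half_pos hε))
  have hrt : ((r : ℚ) : ℝ) + ((t : ℚ) : ℝ) ≤ 1 :=
    (add_le_add (hα.1 ⟨r, hr, rfl⟩) (hβ.1 ⟨t, ht, rfl⟩)).trans hle
  have hrt' : (r : ℚ) + (t : ℚ) ≤ 1 := by exact_mod_cast hrt
  let q : UnitQ := ⟨r + t, add_nonneg r.2.1 t.2.1, hrt'⟩
  have hq := hΓ.mem_of_ax_imp (hP.add r t q α β (min_eq_right hrt').symm)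
    ((hΓ.mem_conj _ _).2 ⟨(hΓ.mem_conj _ _).2 ⟨hr, ht⟩, hαβ⟩)
  rw [hP.mem_iff hΓ] at hq
  change (((r : ℚ) + (t : ℚ) : ℚ) : ℝ) ≤ _ at hq
  push_cast at hq
  linarith

/-! The measure determined by a Boolean representation `e` of the formulas by sets such that `P 1 α`
belongs to `Γ` whenever `α` is represented by the full set. -/

variable {X : Type*} {e : Formula Var m → Set X}

theorem isSetAlgebra_range (φ : Formula Var m) (hneg : ∀ α, e (neg α) = (e α)ᶜ)
    (hconj : ∀ α β, e (conj α β) = e α ∩ e β) :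
    MeasureTheory.IsSetAlgebra {A | ∃ α, A = e α} where
  empty_mem := ⟨contra φ, by simp [contra, hneg, hconj]⟩
  compl_mem := by
    rintro _ ⟨α, rfl⟩
    exact ⟨neg α, (hneg α).symm⟩
  union_mem := by
    rintro _ _ ⟨α, rfl⟩ ⟨β, rfl⟩
    exact ⟨disj α β, by simp [disj, hneg, hconj, Set.compl_inter]⟩

/-- The inclusion makes `¬ α ∨ β` represent the full set, so subadditivity and complementation give
`1 ≤ (1 - μ(α)) + μ(β)`. -/
theorem sSup_mono (hP : IsProbOperator act P) (hΓ : MaximalConsistent act Γ)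
    (hneg : ∀ α, e (neg α) = (e α)ᶜ) (hconj : ∀ α β, e (conj α β) = e α ∩ e β)
    (huniv : ∀ α, e α = Set.univ → P UnitQ.one α ∈ Γ) (h : e α ⊆ e β) :
    sSup (thresholds P Γ α) ≤ sSup (thresholds P Γ β) := by
  have h₁ : e (disj (neg α) β) = Set.univ := by
    rw [disj, hneg, hconj, hneg, hneg, hneg, compl_compl, ← Set.sdiff_eq, Set.sdiff_eq_empty.2 h,
      Set.compl_empty]
  have h₂ := (hP.mem_iff hΓ _ _).1 (huniv _ h₁)
  rw [UnitQ.cast_one] at h₂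
  linarith [hP.sSup_disj_le hΓ (neg α) β, hP.sSup_neg hΓ α]

/-- Well-definedness of the measure: by monotonicity in both directions, formulas representing the
same set have the same thresholds. -/
theorem measure_eq (hP : IsProbOperator act P) (hΓ : MaximalConsistent act Γ)
    (hneg : ∀ α, e (neg α) = (e α)ᶜ) (hconj : ∀ α β, e (conj α β) = e α ∩ e β)
    (huniv : ∀ α, e α = Set.univ → P UnitQ.one α ∈ Γ) (α : Formula Var m) :
    sSup {t | ∃ β, e α = e β ∧ t ∈ thresholds P Γ β} = sSup (thresholds P Γ α) := by
  congr 1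
  ext t
  refine ⟨?_, fun ht => ⟨α, rfl, ht⟩⟩
  rintro ⟨β, h, s, hs, rfl⟩
  refine ⟨s, (hP.mem_iff hΓ _ _).2 (((hP.mem_iff hΓ _ _).1 hs).trans ?_), rfl⟩
  exact hP.sSup_mono hΓ hneg hconj huniv h.symm.subset

theorem isFinAddProb (hP : IsProbOperator act P) (hΓ : MaximalConsistent act Γ)
    (φ : Formula Var m) (hneg : ∀ α, e (neg α) = (e α)ᶜ)
    (hconj : ∀ α β, e (conj α β) = e α ∩ e β)
    (huniv : ∀ α, e α = Set.univ → P UnitQ.one α ∈ Γ) :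
    IsFinAddProb {A | ∃ α, A = e α}
      fun A => sSup {t | ∃ β, A = e β ∧ t ∈ thresholds P Γ β} where
  mem_Icc := by
    rintro _ ⟨α, rfl⟩
    simp only [hP.measure_eq hΓ hneg hconj huniv]
    exact ⟨sSup_nonneg α, sSup_le_one α⟩
  univ := by
    have h : e (neg (contra φ)) = Set.univ := by simp [contra, hneg, hconj]
    rw [← h]
    simp only [hP.measure_eq hΓ hneg hconj huniv]
    refine (sSup_le_one _).antisymm ?_
    rw [← UnitQ.cast_one, ← hP.mem_iff hΓ]
    exact huniv _ h
  union := by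
    rintro _ ⟨α, rfl⟩ _ ⟨β, rfl⟩ hdisj
    have h : e α ∪ e β = e (disj α β) := by simp [disj, hneg, hconj, Set.compl_inter]
    rw [h]
    simp only [hP.measure_eq hΓ hneg hconj huniv]
    refine (hP.sSup_disj_le hΓ α β).antisymm (hP.le_sSup_disj hΓ (huniv _ ?_) ?_)
    · rw [hneg, hconj, hdisj.inter_eq, Set.compl_empty]
    -- Disjointness means that `e α` lies in `e (¬ β)`, which bounds the sum of the two measures by
    -- `1`.
    · have := hP.sSup_mono hΓ hneg hconj huniv (α := α) (β := neg β)
        (by rw [hneg]; exact hdisj.subset_compl_right)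
      linarith [hP.sSup_neg hΓ β]

end IsProbOperator

/-! ### Time in maximal consistent sets -/

theorem MaximalConsistent.preimage_next (hΓ : MaximalConsistent act Γ) (φ : Formula Var m) :
    MaximalConsistent act {α | next α ∈ Γ} := by
  refine hΓ.maximalConsistent_preimage .next (fun α => ?_) φ
  have h := (hΓ.mem_equiv _ _).1 (hΓ.mem_of_ax (.next_neg α))
  rw [hΓ.mem_neg] at h
  exact h.symm

theorem MaximalConsistent.prev_of_prev_contra (hΓ : MaximalConsistent act Γ)
    (h : prev (contra α) ∈ Γ) (β : Formula Var m) : prev β ∈ Γ :=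
  hΓ.app_mem_mono .prev (fun v hn hc => by simp only [imp, contra, hn, hc]; tauto) h

/-- At an initial instant every `●β` holds. Without `●⊥`, the operator `●` commutes with negation in
`Γ`. -/
theorem MaximalConsistent.preimage_prev (hΓ : MaximalConsistent act Γ) (h : prev (contra γ) ∉ Γ) :
    MaximalConsistent act {α | prev α ∈ Γ} := by
  refine hΓ.maximalConsistent_preimage .prev (fun α => ?_) γ
  refine ⟨fun h₁ h₂ => h ?_, fun h₁ => by_contra fun h₂ => h₁ ?_⟩
  · exact hΓ.prev_of_prev_contra
      (hΓ.mem_of_ax_imp (.prev_conj α (neg α)) ((hΓ.mem_conj _ _).2 ⟨h₂, h₁⟩)) _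
  · exact hΓ.mem_of_ax_imp (.prev_neg α) ((hΓ.mem_neg _).2 h₂)

theorem MaximalConsistent.next_preimage_prev (hΓ : MaximalConsistent act Γ)
    (h : prev (contra γ) ∉ Γ) : {α | next α ∈ {α | prev α ∈ Γ}} = Γ := by
  ext α
  have h₁ := hΓ.mem_of_ax_imp (.next_prev_comm₂ α γ) ((hΓ.mem_neg _).2 h)
  have h₂ := hΓ.mem_of_ax (.next_prev α)
  rw [hΓ.mem_equiv] at h₁ h₂
  exact h₁.symm.trans h₂

section Label

variable (w : Start act × ℕ) (S : Start act) (n : ℕ)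

theorem label_maximalConsistent (φ : Formula Var m) : MaximalConsistent act (label w) := by
  obtain ⟨S, n⟩ := w
  induction n with
  | zero => exact S.2.1
  | succ n ih => exact ih.preimage_next φ

theorem mem_label_next : next β ∈ label (S, n) ↔ β ∈ label (S, n + 1) := Iff.rfl

theorem mem_label_next_iterate (i : ℕ) : next^[i] β ∈ label (S, n) ↔ β ∈ label (S, n + i) := by
  induction i generalizing n with
  | zero => rfl
  | succ i ih => rw [Function.iterate_succ_apply', mem_label_next, ih, add_right_comm, add_assoc]

theorem prev_mem_label_zero : prev β ∈ label (S, 0) :=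
  S.2.1.prev_of_prev_contra (S.2.2 β) β

theorem mem_label_prev : prev β ∈ label (S, n + 1) ↔ β ∈ label (S, n) := by
  rw [← mem_label_next, ← (label_maximalConsistent (S, n) β).mem_equiv]
  exact (label_maximalConsistent (S, n) β).mem_of_ax (.next_prev β)

theorem mem_label_prev_iterate (i : ℕ) : prev^[i] β ∈ label (S, n + i) ↔ β ∈ label (S, n) := by
  induction i with
  | zero => rfl
  | succ i ih => rw [Function.iterate_succ_apply', ← add_assoc, mem_label_prev, ih]

/-- The infinitary rule supplies a finite witness; conversely the fixed-point axiom is unfolded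
along the witness. -/
theorem mem_label_untl : untl α β ∈ label (S, n) ↔
    ∃ i, β ∈ label (S, n + i) ∧ ∀ l < i, α ∈ label (S, n + l) := by
  constructor
  · intro h
    have hΓ := label_maximalConsistent (S, n) α
    obtain ⟨_, ⟨i, rfl⟩, hi⟩ := hΓ.exists_premise_notMem (fun h' => (hΓ.mem_neg _).1 h' h)
    dsimp only at hi
    rw [hΓ.mem_neg, not_not, untilWitness, hΓ.mem_conj, hΓ.mem_bigConj,
      mem_label_next_iterate] at hi
    refine ⟨i, hi.2, fun l hl => ?_⟩
    rw [← mem_label_next_iterate]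
    exact hi.1 _ (List.mem_map.2 ⟨l, List.mem_range.2 hl, rfl⟩)
  · rintro ⟨i, hβ, hα⟩
    induction i generalizing n with
    | zero =>
      have hΓ := label_maximalConsistent (S, n) α
      rw [(hΓ.mem_equiv _ _).1 (hΓ.mem_of_ax (.until_next α β)), hΓ.mem_disj]
      exact .inl hβ
    | succ i ih =>
      have hΓ := label_maximalConsistent (S, n) α
      rw [(hΓ.mem_equiv _ _).1 (hΓ.mem_of_ax (.until_next α β)), hΓ.mem_disj, hΓ.mem_conj,
        mem_label_next]
      refine .inr ⟨hα 0 i.succ_pos, ih (n + 1) ?_ fun l hl => ?_⟩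
      · rwa [add_right_comm]
      · rw [add_right_comm]
        exact hα (l + 1) (Nat.succ_lt_succ hl)

theorem mem_label_since : since α β ∈ label (S, n) ↔
    ∃ j ≤ n, β ∈ label (S, j) ∧ ∀ k, j < k → k ≤ n → α ∈ label (S, k) := by
  constructor
  · intro h
    have hΓ := label_maximalConsistent (S, n) α
    obtain ⟨_, ⟨i, rfl⟩, hi⟩ := hΓ.exists_premise_notMem (fun h' => (hΓ.mem_neg _).1 h' h)
    dsimp only at hi
    rw [hΓ.mem_neg, not_not, sinceWitness, hΓ.mem_conj, hΓ.mem_conj, hΓ.mem_bigConj,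
      hΓ.mem_bigConj] at hi
    obtain ⟨⟨hα, hstart⟩, hβ⟩ := hi
    -- The formula `●^(n+1) ⊥` holds at stage `n`, whereas the witness excludes `●^l ⊥` for all `l ≤
    -- i`. So the witness cannot reach back beyond the start of the run.
    have hin : i ≤ n := by
      by_contra! hlt
      have h₁ := hstart _ (List.mem_map.2 ⟨n + 1, List.mem_range.2 (Nat.succ_lt_succ hlt), rfl⟩)
      rw [hΓ.mem_neg, Function.iterate_succ_apply] at h₁
      have h₂ := (mem_label_prev_iterate (β := prev (contra α)) S 0 n).2 (prev_mem_label_zero S)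
      rw [zero_add] at h₂
      exact h₁ h₂
    obtain ⟨j, rfl⟩ := Nat.exists_eq_add_of_le' hin
    refine ⟨j, Nat.le_add_right _ _, (mem_label_prev_iterate S j i).1 hβ, fun k hk hk' => ?_⟩
    obtain ⟨l, hl⟩ := Nat.exists_eq_add_of_le hk'
    have := hα _ (List.mem_map.2 ⟨l, List.mem_range.2 (by omega), rfl⟩)
    rw [hl] at this
    exact (mem_label_prev_iterate S k l).1 this
  · rintro ⟨j, hj, hβ, hα⟩
    induction n, hj using Nat.le_induction with
    | base =>
      have hΓ := label_maximalConsistent (S, j) α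
      rw [(hΓ.mem_equiv _ _).1 (hΓ.mem_of_ax (.since_prev α β)), hΓ.mem_disj]
      exact .inl hβ
    | succ n hj ih =>
      have hΓ := label_maximalConsistent (S, n + 1) α
      rw [(hΓ.mem_equiv _ _).1 (hΓ.mem_of_ax (.since_prev α β)), hΓ.mem_disj, hΓ.mem_conj,
        hΓ.mem_conj, hΓ.mem_neg, mem_label_prev, mem_label_prev]
      exact .inr ⟨(label_maximalConsistent (S, n) α).contra_notMem α,
        hα _ (Nat.lt_succ_of_le hj) le_rfl, ih fun k hk hk' => hα k hk (hk'.trans n.le_succ)⟩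

end Label

/-- Taking `●`-preimages `i` times leads to a set containing `●⊥`, the start of a run; each step
back is inverted by a `○`-preimage (`next_preimage_prev`). -/
theorem MaximalConsistent.exists_label_of_prev_iterate (hΓ : MaximalConsistent act Γ) (i : ℕ)
    (hi : prev^[i] (prev (contra γ)) ∈ Γ)
    (hstart : ∀ l ≤ i, prev^[l] (contra α) ∉ Γ) : ∃ w : Start act × ℕ, label w = Γ := by
  induction i generalizing Γ with
  | zero => exact ⟨(⟨Γ, hΓ, fun β => hΓ.prev_of_prev_contra hi (contra β)⟩, 0), rfl⟩
  | succ i ih =>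
    have hα : prev (contra α) ∉ Γ := hstart 1 (by omega)
    rw [Function.iterate_succ_apply'] at hi
    obtain ⟨⟨S, n⟩, hw⟩ := ih (hΓ.preimage_prev hα) hi fun l hl h => hstart (l + 1) (by omega) (by
      rw [Function.iterate_succ_apply']
      exact h)
    refine ⟨(S, n + 1), Eq.trans ?_ (hΓ.next_preimage_prev hα)⟩
    rw [← hw]
    rfl

/-- Every maximal consistent set is the label of a canonical world. -/
theorem MaximalConsistent.exists_label (hΓ : MaximalConsistent act Γ) (φ : Formula Var m) :
    ∃ w : Start act × ℕ, label w = Γ := by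
  have h : once (prev (contra φ)) ∈ Γ := hΓ.mem_of_ax (.once_prev _)
  -- The infinitary rule for `S` turns `O●⊥` into an `i` with `●^i ●⊥` in `Γ` and no `●^l ⊥` in `Γ`
  -- for `l ≤ i`.
  obtain ⟨_, ⟨i, rfl⟩, hi⟩ := hΓ.exists_premise_notMem (fun h' => (hΓ.mem_neg _).1 h' h)
  dsimp only at hi
  rw [hΓ.mem_neg, not_not, sinceWitness, hΓ.mem_conj, hΓ.mem_conj, hΓ.mem_bigConj] at hi
  refine hΓ.exists_label_of_prev_iterate (α := imp (prev (contra φ)) (prev (contra φ))) i hi.2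
    fun l hl => (hΓ.mem_neg _).1 ?_
  rw [hΓ.mem_bigConj] at hi
  exact hi.1.2 _ (List.mem_map.2 ⟨l, List.mem_range.2 (Nat.lt_succ_of_le hl), rfl⟩)

/-! ### Knowledge in the canonical structure -/

section Knowledge

variable {a : Fin m} {w w' w'' : Start act × ℕ}

theorem canonical_acc_symm (h : (canonical act).acc a w w') : (canonical act).acc a w' w := by
  have hw := label_maximalConsistent w (var (act a))
  have hw' := label_maximalConsistent w' (var (act a))
  obtain ⟨ha, hsub⟩ := h
  refine ⟨hsub (hw.mem_of_ax_imp (.know_act a) ha), fun α hα => ?_⟩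
  by_contra hn
  exact (hw'.mem_neg _).1
    (hsub (hw.mem_of_ax_imp (.know_symm a α) ((hw.mem_neg _).2 hn))) hα

theorem canonical_acc_trans (h : (canonical act).acc a w w') (h' : (canonical act).acc a w' w'') :
    (canonical act).acc a w w'' :=
  ⟨h.1, fun α hα => h'.2 (h.2
    ((label_maximalConsistent w α).mem_of_ax_imp (.know_trans a α) hα))⟩

theorem canonical_acc_refl (ha : var (act a) ∈ label w) : (canonical act).acc a w w := by
  have hw := label_maximalConsistent w (var (act a))
  exact ⟨ha, fun α hα => (hw.mem_imp _ _).1 (hw.mem_of_ax_imp (.know_refl a α) ha) hα⟩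

/-- For active `a`, every maximal consistent set containing all `α` with `K_a α` in the label is the
label of an accessible world. So `β` is derivable from these `α`, and strong necessitation yields
`K_a β`. For inactive `a`, the label contains `K_a ⊥`. -/
theorem mem_label_know [Countable Var] (a : Fin m) (β : Formula Var m) (w : Start act × ℕ) :
    know a β ∈ label w ↔ ∀ w', (canonical act).acc a w w' → β ∈ label w' := by
  have hw := label_maximalConsistent w β
  refine ⟨fun h w' hacc => hacc.2 h, fun h => ?_⟩
  by_cases ha : var (act a) ∈ label w
  · refine hw.app_mem_of_derivable (.know a) (derivable_of_forall_mem fun Γ hΓ hsub => ?_)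
    obtain ⟨w', rfl⟩ := hΓ.exists_label β
    exact h w' ⟨ha, hsub⟩
  · exact hw.app_mem_mono (α := contra β) (.know a)
      (fun v hn hc => by simp only [imp, contra, hn, hc]; tauto)
      (hw.mem_of_ax_imp (.know_deadEnd a β) ((hw.mem_neg _).2 ha))

theorem mem_label_groupK [Countable Var] (β : Formula Var m) (w : Start act × ℕ) :
    groupK β ∈ label w ↔ (canonical act).everyone (fun w => β ∈ label w) w := by
  rw [groupK, (label_maximalConsistent w β).mem_bigConj]
  simp only [List.forall_mem_map, List.mem_finRange, forall_const, mem_label_know]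
  rfl

theorem mem_label_common [Countable Var] (β : Formula Var m) (w : Start act × ℕ) :
    common β ∈ label w ↔ ∀ k, ((canonical act).everyone)^[k] (fun w => β ∈ label w) w := by
  have hw := label_maximalConsistent w β
  have hk : ∀ (k : ℕ) (w : Start act × ℕ), groupK^[k] β ∈ label w ↔
      ((canonical act).everyone)^[k] (fun w => β ∈ label w) w := by
    intro k
    induction k with
    | zero => exact fun _ => Iff.rfl
    | succ k ih =>
      intro w
      rw [Function.iterate_succ_apply', Function.iterate_succ_apply', mem_label_groupK]
      exact iff_of_eq (congrArg (fun p => (canonical act).everyone p w)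
        (funext fun w => propext (ih w)))
  refine ⟨fun h k => (hk k w).1 (hw.mem_of_ax_imp (.common_group β k) h), fun h => ?_⟩
  refine hw.mem_limit ?_
  rintro _ ⟨k, rfl⟩
  exact (hk k w).2 (h k)

end Knowledge

/-! ### Probability in the canonical structure -/

theorem synRuns_neg (α : Formula Var m) : synRuns act (neg α) = (synRuns act α)ᶜ := by
  ext S
  exact (label_maximalConsistent (S, 0) α).mem_neg α

theorem synRuns_conj (α β : Formula Var m) :
    synRuns act (conj α β) = synRuns act α ∩ synRuns act β := by
  ext S
  exact (label_maximalConsistent (S, 0) α).mem_conj α β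

theorem synWorlds_neg (W : Set (Start act × ℕ)) (α : Formula Var m) :
    synWorlds W (neg α) = (synWorlds W α)ᶜ := by
  ext x
  exact (label_maximalConsistent x.1 α).mem_neg α

theorem synWorlds_conj (W : Set (Start act × ℕ)) (α β : Formula Var m) :
    synWorlds W (conj α β) = synWorlds W α ∩ synWorlds W β := by
  ext x
  exact (label_maximalConsistent x.1 α).mem_conj α β

/-- Starts of runs are the maximal consistent sets containing `●⊥`, so `α` is derivable from `●⊥`.
Thus `¬●⊥ ∨ α` is a theorem and has probability one; as `●⊥` has probability one too, so has `α`. -/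
theorem prob_one_mem_of_synRuns_eq_univ [Countable Var] (hΓ : MaximalConsistent act Γ)
    (α : Formula Var m) (h : synRuns act α = Set.univ) : prob UnitQ.one α ∈ Γ := by
  have hd : Derivable act {prev (contra α)} α := derivable_of_forall_mem fun Δ hΔ hsub =>
    Set.eq_univ_iff_forall.1 h
      ⟨Δ, hΔ, fun β => hΔ.prev_of_prev_contra (Set.singleton_subset_iff.1 hsub) (contra β)⟩
  rw [← insert_empty_eq] at hd
  have hd' : Derivable act ∅ (disj (neg (prev (contra α))) α) :=
    hd.deduction.taut_mp fun v hn hc => by simp only [imp, disj, hn, hc]; tauto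
  have hP := isProbOperator_prob (act := act)
  have h₁ := (hP.mem_iff hΓ _ _).1 (hΓ.mem_of_theorem hd'.nec_prob)
  have h₂ := (hP.mem_iff hΓ _ _).1 (hΓ.mem_of_ax (.prob_prev α))
  rw [hP.mem_iff hΓ]
  rw [UnitQ.cast_one] at *
  linarith [hP.sSup_disj_le hΓ (neg (prev (contra α))) α, hP.sSup_neg hΓ (prev (contra α))]

/-- The worlds exhaust the maximal consistent sets, so `α` is a theorem and necessitation applies.
-/
theorem agProb_one_mem_of_synWorlds_eq_univ [Countable Var] (hΓ : MaximalConsistent act Γ)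
    (a : Fin m) (α : Formula Var m)
    (h : synWorlds (Set.univ : Set (Start act × ℕ)) α = Set.univ) :
    agProb a UnitQ.one α ∈ Γ := by
  refine hΓ.mem_of_theorem (Derivable.nec_agProb a (derivable_of_forall_mem fun Δ hΔ _ => ?_))
  obtain ⟨w, rfl⟩ := hΔ.exists_label α
  exact Set.eq_univ_iff_forall.1 h ⟨w, trivial⟩

theorem canonical_runMeas [Countable Var] (w : Start act × ℕ) (α : Formula Var m) :
    (canonical act).runMeas w (synRuns act α) = sSup (runThresholds (label w) α) :=
  isProbOperator_prob.measure_eq (label_maximalConsistent w α) synRuns_neg synRuns_conj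
    (prob_one_mem_of_synRuns_eq_univ (label_maximalConsistent w α)) α

theorem canonical_agMeas [Countable Var] (a : Fin m) (w : Start act × ℕ) (α : Formula Var m) :
    (canonical act).agMeas a w (synWorlds Set.univ α) = sSup (agThresholds a (label w) α) :=
  (isProbOperator_agProb a).measure_eq (label_maximalConsistent w α) (synWorlds_neg _)
    (synWorlds_conj _) (agProb_one_mem_of_synWorlds_eq_univ (label_maximalConsistent w α) a) α

/-! ### The canonical model -/

theorem canonical_isModel [Countable Var] (φ : Formula Var m) (hne : Nonempty (Start act)) :
    (canonical act).IsModel act where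
  nonempty := hne
  active_iff _ _ _ := Iff.rfl
  symm _ _ _ := canonical_acc_symm
  trans _ _ _ _ := canonical_acc_trans
  not_active_iff _ w := ⟨fun h _ hacc => h hacc.1, fun h ha => h w (canonical_acc_refl ha)⟩
  refl _ _ := canonical_acc_refl
  run_algebra _ := IsProbOperator.isSetAlgebra_range φ synRuns_neg synRuns_conj
  run_prob w := isProbOperator_prob.isFinAddProb (label_maximalConsistent w φ) φ synRuns_neg
    synRuns_conj (prob_one_mem_of_synRuns_eq_univ (label_maximalConsistent w φ))
  ag_nonempty _ w := ⟨w, trivial⟩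
  ag_algebra _ _ := IsProbOperator.isSetAlgebra_range φ (synWorlds_neg _) (synWorlds_conj _)
  ag_prob a w := (isProbOperator_agProb a).isFinAddProb (label_maximalConsistent w φ) φ
    (synWorlds_neg _) (synWorlds_conj _)
    (agProb_one_mem_of_synWorlds_eq_univ (label_maximalConsistent w φ) a)

/-- The truth lemma. -/
theorem canonical_sat [Countable Var] (α : Formula Var m) :
    (canonical act).Sat α = fun w => α ∈ label (act := act) w := by
  induction α with
  | var p => rfl
  | neg α ih =>
    funext w
    rw [Structure.Sat, ih]
    exact propext ((label_maximalConsistent w α).mem_neg α).symm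
  | conj α β ihα ihβ =>
    funext w
    rw [Structure.Sat, ihα, ihβ]
    exact propext ((label_maximalConsistent w α).mem_conj α β).symm
  | next α ih =>
    funext w
    rw [Structure.Sat, ih]
    rfl
  | untl α β ihα ihβ =>
    funext ⟨S, n⟩
    rw [Structure.Sat, ihα, ihβ]
    refine propext (Iff.trans ⟨?_, ?_⟩ (mem_label_untl S n).symm)
    · rintro ⟨j, hj, hβ, hα⟩
      obtain ⟨i, rfl⟩ := Nat.exists_eq_add_of_le hj
      exact ⟨i, hβ, fun l hl => hα _ (Nat.le_add_right _ _) (Nat.add_lt_add_left hl n)⟩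
    · rintro ⟨i, hβ, hα⟩
      refine ⟨n + i, Nat.le_add_right _ _, hβ, fun k hk hk' => ?_⟩
      obtain ⟨l, rfl⟩ := Nat.exists_eq_add_of_le hk
      exact hα l (Nat.lt_of_add_lt_add_left hk')
  | prev α ih =>
    funext ⟨S, n⟩
    rw [Structure.Sat, ih]
    cases n with
    -- At time zero both sides hold for every formula.
    | zero => exact propext ⟨fun _ => prev_mem_label_zero S, fun _ => .inl rfl⟩
    | succ n =>
      refine propext (Iff.trans ⟨?_, ?_⟩ (mem_label_prev S n).symm)
      · exact fun h => (h.resolve_left n.succ_ne_zero).2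
      · exact fun h => .inr ⟨n.succ_pos, h⟩
  | since α β ihα ihβ =>
    funext ⟨S, n⟩
    rw [Structure.Sat, ihα, ihβ]
    exact propext (mem_label_since S n).symm
  | know a α ih =>
    funext w
    rw [Structure.Sat, ih]
    exact propext (mem_label_know a α w).symm
  | common α ih =>
    funext w
    rw [Structure.Sat, ih]
    exact propext (mem_label_common α w).symm
  | prob s α ih =>
    funext w
    rw [Structure.Sat, ih]
    refine propext (Iff.trans ?_
      (isProbOperator_prob.mem_iff (label_maximalConsistent w α) s α).symm)
    exact iff_of_eq (congrArg (((s : ℚ) : ℝ) ≤ ·) (canonical_runMeas w α))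
  | agProb a s α ih =>
    funext w
    rw [Structure.Sat, ih]
    refine propext (Iff.trans ?_
      ((isProbOperator_agProb a).mem_iff (label_maximalConsistent w α) s α).symm)
    exact iff_of_eq (congrArg (((s : ℚ) : ℝ) ≤ ·) (canonical_agMeas a w α))

theorem canonical_sat_iff [Countable Var] (α : Formula Var m) (w : Start act × ℕ) :
    (canonical act).Sat α w ↔ α ∈ label w :=
  iff_of_eq (congrFun (canonical_sat α) w)

end PTEL

theorem theorem8 {Var : Type u} [Countable Var] [Nonempty Var] {m : ℕ} (act : Fin m → Var)
    (T : Set (PTEL.Formula Var m)) (hT : PTEL.Consistent act T) :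
    -- the canonical structure is a model, and it is measurable
    (PTEL.canonical act).IsModel act ∧ (PTEL.canonical act).IsMeasurable ∧
    -- its worlds are labelled by maximal consistent sets
    (∀ w : PTEL.Start act × ℕ, PTEL.MaximalConsistent act (PTEL.label w)) ∧
    -- `T` has a maximal consistent extension, and each one is the label of a world
    (∃ T' : Set (PTEL.Formula Var m), T ⊆ T' ∧ PTEL.MaximalConsistent act T') ∧
    (∀ T' : Set (PTEL.Formula Var m), T ⊆ T' → PTEL.MaximalConsistent act T' →
      ∃ w : PTEL.Start act × ℕ, PTEL.label w = T') ∧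
    -- the measures are given by the suprema of the thresholds
    (∀ (w : PTEL.Start act × ℕ) (α : PTEL.Formula Var m),
      IsLUB (PTEL.runThresholds (PTEL.label w) α)
        ((PTEL.canonical act).runMeas w (PTEL.synRuns act α))) ∧
    (∀ (a : Fin m) (w : PTEL.Start act × ℕ) (α : PTEL.Formula Var m),
      IsLUB (PTEL.agThresholds a (PTEL.label w) α)
        ((PTEL.canonical act).agMeas a w (PTEL.synWorlds Set.univ α))) ∧
    -- the syntactic sets are the truth sets
    (∀ α : PTEL.Formula Var m, PTEL.synRuns act α = (PTEL.canonical act).truthRuns α) ∧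
    (∀ (a : Fin m) (w : PTEL.Start act × ℕ) (α : PTEL.Formula Var m),
      PTEL.synWorlds Set.univ α = (PTEL.canonical act).truthWorlds a w α) := by
  obtain ⟨p⟩ := ‹Nonempty Var›
  have hext := hT.exists_maximalConsistent (.var p)
  have hruns : ∀ α : PTEL.Formula Var m,
      PTEL.synRuns act α = (PTEL.canonical act).truthRuns α := fun α =>
    Set.ext fun S => (PTEL.canonical_sat_iff α (S, 0)).symm
  have hworlds : ∀ (a : Fin m) (w : PTEL.Start act × ℕ) (α : PTEL.Formula Var m),
      PTEL.synWorlds Set.univ α = (PTEL.canonical act).truthWorlds a w α := fun a w α =>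
    Set.ext fun x => (PTEL.canonical_sat_iff α x.1).symm
  -- Consistency of `T` enters here too: a maximal consistent extension labels a world, and the run
  -- of that world exists.
  have hne : Nonempty (PTEL.Start act) := by
    obtain ⟨Γ, -, hΓ⟩ := hext
    obtain ⟨w, -⟩ := hΓ.exists_label (.var p)
    exact ⟨w.1⟩
  refine ⟨PTEL.canonical_isModel (.var p) hne,
    fun w α => ⟨⟨α, (hruns α).symm⟩, fun a => ⟨α, (hworlds a w α).symm⟩⟩,
    fun w => PTEL.label_maximalConsistent w (.var p), hext,
    fun _ _ hΓ => hΓ.exists_label (.var p), fun w α => ?_, fun a w α => ?_, hruns, hworlds⟩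
  · rw [PTEL.canonical_runMeas]
    exact PTEL.isProbOperator_prob.isLUB_thresholds (PTEL.label_maximalConsistent w α) α
  · rw [PTEL.canonical_agMeas]
    exact (PTEL.isProbOperator_agProb a).isLUB_thresholds (PTEL.label_maximalConsistent w α) α
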